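/- Let $g_k$ denote a standard Gaussian vector in $\mathbb{R}^k$, let $\|\cdot\|$ denote the Euclidean norm of vectors and the spectral norm of matrices, and let $\Pi_W$ be the orthogonal projection onto a subspace $W$. For integers $r,d\ge 0$ and $\alpha>0$, say that a polynomial $P$ on $\mathbb{R}^n$ of degree at most $d$ is a normalized $\alpha$-non-degenerate polynomial of rank $r$ with hidden subspace $U^*\subseteq\mathbb{R}^n$ if there are an orthonormal basis $u_1,\dots,u_r$ of $U^*$ and an $r$-variate polynomial $h$ with $P(x)=h(\langle u_1,x\rangle,\dots,\langle u_r,x\rangle)$ for all $x$, such that the matrix $G=\mathbb{E}[\nabla h(g_r)\nabla h(g_r)^\top]$ satisfies $G\succeq\alpha\|G\|I_r$ and $G\preceq I_r$, and moreover $\mathbb{E}[P(g_n)]=0$ and $d\cdot\mathrm{Var}[P(g_n)]\ge\alpha$. For $\tau>0$ and orthonormal $V=\{v_1,\dots,v_\ell\}\subset\mathbb{R}^n$ put $$M^\tau_V=\Pi_{\mathrm{span}(V)^\perp}\;\mathbb{E}_{x\sim\mathcal N(0,I_n)}\Big[\mathbf 1\{|P(x)|>\tau\ \text{and}\ |\langle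 v_i,x\rangle|\le 1\ \text{for all } i\}\,(xx^\top-I_n)\Big]\;\Pi_{\mathrm{span}(V)^\perp}.$$ Lemma. For all $r,d$ and $\alpha>0$ there are constants $\tau=\tau(r,d,\alpha)>0$ and $C=C(r,d,\alpha)>0$ such that the following holds for every $n$ and every normalized $\alpha$-non-degenerate polynomial $P$ on $\mathbb{R}^n$ of rank $r$ and degree at most $d$ with hidden subspace $U^*$. Let $0\le\ell<r$, let $v_1,\dots,v_\ell$ be orthonormal with $\|\Pi_{U^*}v_i\|\ge 1-\rho$ for all $i$, and let $M$ be a real $n\times n$ matrix with $\|M-M^\tau_V\|\le\rho$. Let $v\in\mathbb{R}^n$ be a unit top eigenvector of $M$, that is, $Mv=\mu v$ with $\mu\in\mathbb{R}$ and $\mathrm{Re}\,z\le\mu$ for every complex eigenvalue $z$ of $M$ (for symmetric $M$: a unit eigenvector for the largest eigenvalue). Then $$\|\Pi_{U^*}v\|\ \ge\ 1-C\max(1,\ell)^2\rho .$$ -/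

import Mathlib

open MeasureTheory ProbabilityTheory
open scoped Matrix.Norms.L2Operator

noncomputable section

/-- The matrix `E_{g ∼ N(0, I_r)} [∇h(g) ∇h(g)ᵀ]` of an `r`-variate polynomial `h`. -/
def gradMoment {r : ℕ} (h : MvPolynomial (Fin r) ℝ) : Matrix (Fin r) (Fin r) ℝ :=
  Matrix.of fun i j =>
    ∫ g : EuclideanSpace ℝ (Fin r),
      MvPolynomial.eval (fun k => g k) (MvPolynomial.pderiv i h) *
        MvPolynomial.eval (fun k => g k) (MvPolynomial.pderiv j h)
      ∂(stdGaussian (EuclideanSpace ℝ (Fin r)))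

/-- `h` is `α`-non-degenerate: `G ⪰ α ‖G‖ I` for `G = E[∇h(g) ∇h(g)ᵀ]`
(`‖·‖` is the spectral norm). -/
def NonDegenerate {r : ℕ} (α : ℝ) (h : MvPolynomial (Fin r) ℝ) : Prop :=
  (gradMoment h - (α * ‖gradMoment h‖) • (1 : Matrix (Fin r) (Fin r) ℝ)).PosSemidef

/-- `P` is an `n`-variate polynomial of degree at most `d` that is `α`-non-degenerate of rank `r`
with hidden subspace `U`: `P(x) = h(⟨u₁, x⟩, …, ⟨u_r, x⟩)` with `u` an orthonormal basis of `U` and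
`h` non-degenerate. It is normalized: `E[P] = 0`, `E[∇h ∇hᵀ] ⪯ I` and `Var[P] ≥ α / d`. -/
structure IsHiddenSubspacePoly {n : ℕ} (r d : ℕ) (α : ℝ)
    (U : Submodule ℝ (EuclideanSpace ℝ (Fin n))) (P : MvPolynomial (Fin n) ℝ) : Prop where
  degree_le : P.totalDegree ≤ d
  exists_link : ∃ (u : Fin r → EuclideanSpace ℝ (Fin n)) (h : MvPolynomial (Fin r) ℝ),
    Orthonormal ℝ u ∧ Submodule.span ℝ (Set.range u) = U ∧
    (∀ x : EuclideanSpace ℝ (Fin n),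
      MvPolynomial.eval (fun k => x k) P = MvPolynomial.eval (fun i => inner ℝ (u i) x) h) ∧
    NonDegenerate α h ∧
    ((1 : Matrix (Fin r) (Fin r) ℝ) - gradMoment h).PosSemidef
  mean_eq_zero : ∫ x : EuclideanSpace ℝ (Fin n), MvPolynomial.eval (fun k => x k) P
    ∂(stdGaussian (EuclideanSpace ℝ (Fin n))) = 0
  le_variance : α ≤ d * variance
    (fun x : EuclideanSpace ℝ (Fin n) => MvPolynomial.eval (fun k => x k) P)
    (stdGaussian (EuclideanSpace ℝ (Fin n)))

/-- The event `{|P(x)| > τ} ∧ {|⟨v_i, x⟩| ≤ 1 for all i}`. -/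
def trimEvent {n ℓ : ℕ} (P : MvPolynomial (Fin n) ℝ) (τ : ℝ)
    (v : Fin ℓ → EuclideanSpace ℝ (Fin n)) : Set (EuclideanSpace ℝ (Fin n)) :=
  {x | τ < |MvPolynomial.eval (fun k => x k) P| ∧ ∀ i, |inner ℝ (v i) x| ≤ 1}

/-- The matrix `E_{x ∼ N(0, I_n)} [1{|P(x)| > τ, |⟨v_i, x⟩| ≤ 1 ∀ i} (x xᵀ - I)]`. -/
def trimmedMoment {n ℓ : ℕ} (P : MvPolynomial (Fin n) ℝ) (τ : ℝ)
    (v : Fin ℓ → EuclideanSpace ℝ (Fin n)) : Matrix (Fin n) (Fin n) ℝ :=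
  Matrix.of fun i j =>
    ∫ x : EuclideanSpace ℝ (Fin n),
      (trimEvent P τ v).indicator
        (fun x => x i * x j - (1 : Matrix (Fin n) (Fin n) ℝ) i j) x
      ∂(stdGaussian (EuclideanSpace ℝ (Fin n)))

/-- The matrix of the orthogonal projection of `ℝⁿ` onto the subspace `W`. -/
def projMatrix {n : ℕ} (W : Submodule ℝ (EuclideanSpace ℝ (Fin n))) : Matrix (Fin n) (Fin n) ℝ :=
  (Matrix.toEuclideanCLM (n := Fin n) (𝕜 := ℝ)).symm W.starProjection

/-- `M^τ_V = Π_{V^⊥} · E[1{|P(x)| > τ, |⟨v_i, x⟩| ≤ 1 ∀ i} (x xᵀ - I)] · Π_{V^⊥}`. -/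
def trimmedMatrix {n ℓ : ℕ} (P : MvPolynomial (Fin n) ℝ) (τ : ℝ)
    (v : Fin ℓ → EuclideanSpace ℝ (Fin n)) : Matrix (Fin n) (Fin n) ℝ :=
  projMatrix (Submodule.span ℝ (Set.range v))ᗮ * trimmedMoment P τ v *
    projMatrix (Submodule.span ℝ (Set.range v))ᗮ

/-- `w` is a unit eigenvector of `M` for its largest eigenvalue. `M` need not be symmetric, so
"largest" is with respect to the real parts of all complex eigenvalues; for symmetric `M` the
complex eigenvalues are exactly the real ones and this is the usual top eigenvector. -/
def IsTopEigenvector {n : ℕ} (M : Matrix (Fin n) (Fin n) ℝ) (w : EuclideanSpace ℝ (Fin n)) :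
    Prop :=
  ‖w‖ = 1 ∧ ∃ μ : ℝ, Matrix.toEuclideanCLM (n := Fin n) (𝕜 := ℝ) M w = μ • w ∧
    ∀ z ∈ spectrum ℂ (M.map (fun a : ℝ => (a : ℂ))), z.re ≤ μ

end

/-! ### Gaussian integrals: resampling a coordinate, marginals, moments -/

section GaussianTools

variable {E : Type*} [NormedAddCommGroup E] [InnerProductSpace ℝ E] [FiniteDimensional ℝ E]
  [MeasurableSpace E] [BorelSpace E]

/-! Write `A` for the trimmed matrix, a symmetric matrix. Two facts about `A` and one about
perturbations give the result.

`A` has a direction with quadratic form bounded below. Normalized links of bounded degree form a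
compact set, so `τ` can be chosen such that `|P x| > τ` forces `‖Π_U x‖² > 2r + 1`. On the trimming
event the `V`-part of `x` has squared norm at most `ℓ < r`, so the excess lies in `Vᗮ ⊓ (U ⊔ V)`, of
dimension at most `r`, and the trace of `A` there is at least the probability of the event. That
probability is bounded below, again by compactness: a non-degenerate polynomial is unbounded on a
slab with fewer than `r` normals (`exists_uniform_threshold_and_tail`, `exists_large_direction`).

`A` nearly annihilates `Uᗮ`. For `b ∈ Uᗮ`, `P` is constant along `b`. Were the slabs also invariant,
integrating out the `b`-coordinate would give zero. Since `|⟨v i, b⟩| ≤ √(2ρ) ‖b‖`, tilting the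
slabs to make them invariant changes the event only on thin shells, and the error is `O(ℓ√ρ)`
(`abs_integral_slab_indicator_le`, `abs_inner_trimmedMatrix_le`).

`M` need not be symmetric, so Weyl's inequality is unavailable. The rank of `A` is at most `2r`,
which leaves a spectral gap of size independent of `n`; an indefinite quadratic form then acts as a
Lyapunov function and shows that the top eigenvalue `μ` stays bounded below
(`half_le_of_spectrum_re_le`).

Finally let `b` be the `Uᗮ`-part of the eigenvector `w`. Pairing `M w = μ w` with `b` gives `‖b‖ =
O(√ρ)`, and by Pythagoras the loss in `‖Π_U w‖` is `O(‖b‖²) = O(ρ)`. -/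

theorem stdGaussian_map_resample {p : E} (hp : ‖p‖ = 1) :
    ((stdGaussian E).prod (gaussianReal 0 1)).map
      (fun z : E × ℝ => z.1 - (inner ℝ p z.1 : ℝ) • p + z.2 • p) = stdGaussian E := by
  have : IsProbabilityMeasure (((stdGaussian E).prod (gaussianReal 0 1)).map
      (fun z : E × ℝ => z.1 - (inner ℝ p z.1 : ℝ) • p + z.2 • p)) :=
    Measure.isProbabilityMeasure_map (by fun_prop)
  apply Measure.ext_of_charFun
  ext t
  rw [charFun_apply, integral_map (by fun_prop) (by fun_prop)]
  have key : ∀ z : E × ℝ,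
      Complex.exp (inner ℝ (z.1 - (inner ℝ p z.1 : ℝ) • p + z.2 • p) t * Complex.I) =
      Complex.exp (inner ℝ z.1 (t - (inner ℝ p t : ℝ) • p) * Complex.I) *
        Complex.exp (z.2 * (inner ℝ p t : ℝ) * Complex.I) := by
    intro z
    rw [← Complex.exp_add]
    congr 1
    simp only [inner_add_left, inner_sub_left, inner_sub_right, real_inner_smul_left,
      real_inner_smul_right, real_inner_comm p z.1]
    push_cast
    ring
  simp_rw [key]
  rw [integral_prod_mul (f := fun x : E =>
      Complex.exp (inner ℝ x (t - (inner ℝ p t : ℝ) • p) * Complex.I))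
      (g := fun s : ℝ => Complex.exp (s * (inner ℝ p t : ℝ) * Complex.I)),
    ← charFun_apply, charFun_stdGaussian, charFun_stdGaussian]
  have h2 : ∫ s : ℝ, Complex.exp (s * (inner ℝ p t : ℝ) * Complex.I) ∂(gaussianReal 0 1) =
      Complex.exp (-(inner ℝ p t : ℝ) ^ 2 / 2) := by
    have := charFun_gaussianReal (μ := 0) (v := 1) (inner ℝ p t)
    rw [charFun_apply_real] at this
    simp only [mul_comm (Complex.ofReal _) (Complex.ofReal (inner ℝ p t))]
    rw [this]
    simp [neg_div]
  rw [h2, ← Complex.exp_add]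
  congr 1
  have h3 : ‖t - (inner ℝ p t : ℝ) • p‖ ^ 2 = ‖t‖ ^ 2 - (inner ℝ p t : ℝ) ^ 2 := by
    rw [norm_sub_sq_real, real_inner_smul_right, norm_smul, hp, real_inner_comm p t]
    simp
    ring
  rw [← Complex.ofReal_pow, h3]
  push_cast
  ring

/-- Fubini along `p`: given the component orthogonal to `p`, the `p`-coordinate is an independent
standard normal. -/
theorem lintegral_stdGaussian_resample {p : E} (hp : ‖p‖ = 1) {f : E → ENNReal}
    (hf : Measurable f) :
    ∫⁻ x, f x ∂(stdGaussian E) =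
      ∫⁻ x, ∫⁻ t, f (x - (inner ℝ p x : ℝ) • p + t • p) ∂(gaussianReal 0 1)
        ∂(stdGaussian E) := by
  conv_lhs => rw [← stdGaussian_map_resample hp]
  rw [lintegral_map hf (by fun_prop), lintegral_prod]
  exact (hf.comp (by fun_prop)).aemeasurable

theorem integral_stdGaussian_resample {p : E} (hp : ‖p‖ = 1) {f : E → ℝ}
    (hf : Integrable f (stdGaussian E)) :
    ∫ x, f x ∂(stdGaussian E) =
      ∫ x, ∫ t, f (x - (inner ℝ p x : ℝ) • p + t • p) ∂(gaussianReal 0 1)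
        ∂(stdGaussian E) := by
  have hm : AEMeasurable (fun z : E × ℝ => z.1 - (inner ℝ p z.1 : ℝ) • p + z.2 • p)
    ((stdGaussian E).prod (gaussianReal 0 1)) := by fun_prop
  have hf' := hf
  rw [← stdGaussian_map_resample hp] at hf'
  conv_lhs => rw [← stdGaussian_map_resample hp]
  rw [integral_map hm hf'.aestronglyMeasurable]
  exact integral_prod _ (hf'.comp_aemeasurable hm)

theorem stdGaussian_map_orthonormal {r : ℕ} {u : Fin r → E} (hu : Orthonormal ℝ u) :
    (stdGaussian E).map (fun x => (WithLp.toLp 2 fun i => (inner ℝ (u i) x : ℝ))) =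
      stdGaussian (EuclideanSpace ℝ (Fin r)) := by
  have hm : Measurable (fun x : E => (WithLp.toLp 2 fun i => (inner ℝ (u i) x : ℝ) :
      EuclideanSpace ℝ (Fin r))) := by fun_prop
  have : IsProbabilityMeasure ((stdGaussian E).map (fun x : E =>
      (WithLp.toLp 2 fun i => (inner ℝ (u i) x : ℝ) : EuclideanSpace ℝ (Fin r)))) :=
    Measure.isProbabilityMeasure_map hm.aemeasurable
  apply Measure.ext_of_charFun
  ext t
  rw [charFun_apply, integral_map hm.aemeasurable (by fun_prop), charFun_stdGaussian]
  have key : ∀ x : E, (inner ℝ (WithLp.toLp 2 fun i => (inner ℝ (u i) x : ℝ) :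
      EuclideanSpace ℝ (Fin r)) t : ℝ) = inner ℝ x (∑ i, t i • u i) := by
    intro x
    simp only [inner_sum, real_inner_smul_right, PiLp.inner_apply, real_inner_comm x]
    simp
  simp_rw [key]
  rw [← charFun_apply, charFun_stdGaussian]
  congr 3
  have : ‖∑ i, t i • u i‖ ^ 2 = ‖t‖ ^ 2 := by
    rw [← real_inner_self_eq_norm_sq, hu.inner_sum, EuclideanSpace.real_norm_sq_eq]
    simp [sq]
  exact_mod_cast this

theorem stdGaussian_map_inner {p : E} (hp : ‖p‖ = 1) :
    (stdGaussian E).map (fun x => (inner ℝ p x : ℝ)) = gaussianReal 0 1 := by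
  have hm : Measurable (fun x : E => (inner ℝ p x : ℝ)) := by fun_prop
  have : IsProbabilityMeasure ((stdGaussian E).map (fun x => (inner ℝ p x : ℝ))) :=
    Measure.isProbabilityMeasure_map hm.aemeasurable
  apply Measure.ext_of_charFun
  ext t
  rw [charFun_apply, integral_map hm.aemeasurable (by fun_prop), charFun_gaussianReal]
  have key : ∀ x : E, (inner ℝ (inner ℝ p x : ℝ) t : ℝ) = inner ℝ x (t • p) := by
    intro x
    rw [real_inner_smul_right, real_inner_comm x]
    simp
  simp_rw [key]
  rw [← charFun_apply, charFun_stdGaussian, norm_smul, hp]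
  simp [neg_div]
  norm_cast
  simp

theorem memLp_inner_stdGaussian (y : E) (p : ENNReal) (hp : p ≠ ⊤) :
    MemLp (fun x => (inner ℝ y x : ℝ)) p (stdGaussian E) :=
  IsGaussian.memLp_dual (stdGaussian E) (innerSL ℝ y) p hp

theorem integrable_inner_mul_inner_stdGaussian (y q : E) :
    Integrable (fun x => (inner ℝ y x : ℝ) * inner ℝ q x) (stdGaussian E) :=
  (memLp_inner_stdGaussian y 2 (by simp)).integrable_mul (memLp_inner_stdGaussian q 2 (by simp))

theorem integral_inner_sq_stdGaussian (y : E) :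
    ∫ x, (inner ℝ y x : ℝ) ^ 2 ∂(stdGaussian E) = ‖y‖ ^ 2 := by
  have h := variance_dual_stdGaussian (innerSL ℝ y)
  rw [variance_of_integral_eq_zero (by fun_prop) (integral_strongDual_stdGaussian _)] at h
  simpa using h

theorem integrable_pow_gaussianReal (k : ℕ) :
    Integrable (fun t : ℝ => t ^ k) (gaussianReal 0 1) := by
  have h := (memLp_id_gaussianReal (μ := 0) (v := 1) k).integrable_norm_pow'
  refine (integrable_norm_iff (by fun_prop)).1 ?_
  simpa using h

theorem integral_inner_pow_stdGaussian {p : E} (hp : ‖p‖ = 1) (k : ℕ) :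
    Integrable (fun x => (inner ℝ p x : ℝ) ^ k) (stdGaussian E) ∧
    ∫ x, (inner ℝ p x : ℝ) ^ k ∂(stdGaussian E) = ∫ t, t ^ k ∂(gaussianReal 0 1) := by
  have hm : AEMeasurable (fun x : E => (inner ℝ p x : ℝ)) (stdGaussian E) := by fun_prop
  constructor
  · have h := integrable_pow_gaussianReal k
    rw [← stdGaussian_map_inner hp] at h
    exact h.comp_aemeasurable hm
  · rw [← stdGaussian_map_inner hp, integral_map hm (by fun_prop)]

theorem integral_sq_gaussianReal : ∫ t : ℝ, t ^ 2 ∂(gaussianReal 0 1) = 1 := by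
  have h := variance_id_gaussianReal (μ := 0) (v := 1)
  rw [variance_of_integral_eq_zero (by fun_prop) (by simp)] at h
  simpa using h

/-- Serves twice: a continuous function vanishing almost everywhere vanishes, and nonempty open
events have positive probability. -/
instance isOpenPosMeasure_stdGaussian (r : ℕ) :
    (stdGaussian (EuclideanSpace ℝ (Fin r))).IsOpenPosMeasure := by
  have : (gaussianReal 0 1).IsOpenPosMeasure :=
    (gaussianReal_absolutelyContinuous' 0 one_ne_zero).isOpenPosMeasure
  rw [← map_pi_eq_stdGaussian]
  exact (PiLp.continuous_toLp 2 _).isOpenPosMeasure_map (WithLp.toLp_surjective 2)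

theorem integrable_eval_stdGaussian {r : ℕ} (h : MvPolynomial (Fin r) ℝ) :
    Integrable (fun x : EuclideanSpace ℝ (Fin r) => MvPolynomial.eval (fun k => x k) h)
      (stdGaussian (EuclideanSpace ℝ (Fin r))) := by
  rw [← map_pi_eq_stdGaussian, integrable_map_measure (by
    have := MvPolynomial.continuous_eval h
    exact (Continuous.aestronglyMeasurable (by fun_prop))) (by fun_prop)]
  simp only [Function.comp_def, MvPolynomial.eval_eq']
  refine integrable_finsetSum _ fun m _ => Integrable.const_mul ?_ _
  exact Integrable.fintype_prod (f := fun i (t : ℝ) => t ^ m i)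
    fun i => integrable_pow_gaussianReal (m i)

end GaussianTools

/-! ### Normalized link polynomials: unboundedness on slabs and uniform constants -/

section PolynomialClass

/-- The Gaussian mean as a linear functional on polynomials. -/
noncomputable def gaussMean (r : ℕ) : MvPolynomial (Fin r) ℝ →ₗ[ℝ] ℝ where
  toFun p := ∫ x : EuclideanSpace ℝ (Fin r), MvPolynomial.eval (fun k => x k) p
    ∂(stdGaussian (EuclideanSpace ℝ (Fin r)))
  map_add' p q := by
    simp only [map_add]
    exact integral_add (integrable_eval_stdGaussian p) (integrable_eval_stdGaussian q)
  map_smul' c p := by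
    simp only [MvPolynomial.smul_eval, RingHom.id_apply, smul_eq_mul]
    exact integral_const_mul _ _

variable {r : ℕ}

theorem gradMoment_apply (h : MvPolynomial (Fin r) ℝ) (i j : Fin r) :
    gradMoment h i j = gaussMean r (MvPolynomial.pderiv i h * MvPolynomial.pderiv j h) := by
  simp [gradMoment, gaussMean]

theorem gradMoment_isHermitian (h : MvPolynomial (Fin r) ℝ) : (gradMoment h).IsHermitian := by
  ext i j
  simp [gradMoment_apply, mul_comm]

/-- The derivative of `h` in direction `y`. -/
noncomputable def dirDeriv (y : Fin r → ℝ) (h : MvPolynomial (Fin r) ℝ) :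
    MvPolynomial (Fin r) ℝ := ∑ i, y i • MvPolynomial.pderiv i h

theorem dotProduct_gradMoment_mulVec (h : MvPolynomial (Fin r) ℝ) (y : Fin r → ℝ) :
    y ⬝ᵥ (gradMoment h).mulVec y = gaussMean r (dirDeriv y h ^ 2) := by
  rw [dirDeriv, sq, Finset.sum_mul_sum]
  simp only [map_sum, dotProduct, Matrix.mulVec,
    gradMoment_apply, Finset.mul_sum, smul_mul_smul_comm, map_smul, smul_eq_mul]
  refine Finset.sum_congr rfl fun i _ => Finset.sum_congr rfl fun j _ => ?_
  ring

theorem continuous_eval_euclidean (p : MvPolynomial (Fin r) ℝ) :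
    Continuous fun x : EuclideanSpace ℝ (Fin r) => MvPolynomial.eval (fun k => x k) p :=
  (MvPolynomial.continuous_eval p).comp (by fun_prop)

theorem gaussMean_sq_nonneg (p : MvPolynomial (Fin r) ℝ) : 0 ≤ gaussMean r (p ^ 2) :=
  integral_nonneg fun x => by simp only [map_pow]; positivity

theorem gaussMean_sq_eq_zero {p : MvPolynomial (Fin r) ℝ} (h : gaussMean r (p ^ 2) = 0) :
    p = 0 := by
  have h' := (integral_eq_zero_iff_of_nonneg (fun x : EuclideanSpace ℝ (Fin r) => by
    simp only [map_pow, Pi.zero_apply]; positivity) (integrable_eval_stdGaussian (p ^ 2))).1 h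
  have h2 := (Continuous.ae_eq_iff_eq _ (continuous_eval_euclidean (p ^ 2)) continuous_const).1 h'
  refine MvPolynomial.funext fun x => ?_
  have h3 : MvPolynomial.eval x (p ^ 2) = 0 := congrFun h2 (WithLp.toLp 2 x)
  simpa using h3

/-- The restriction of `h` to the line through `x` with direction `y`. -/
noncomputable def restrictLine (x y : Fin r → ℝ) (h : MvPolynomial (Fin r) ℝ) : Polynomial ℝ :=
  MvPolynomial.aeval (fun i => Polynomial.C (x i) + Polynomial.X * Polynomial.C (y i)) h

theorem eval_restrictLine (x y : Fin r → ℝ) (h : MvPolynomial (Fin r) ℝ) (t : ℝ) :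
    (restrictLine x y h).eval t = MvPolynomial.eval (x + t • y) h := by
  unfold restrictLine
  rw [← Polynomial.coe_evalRingHom, MvPolynomial.aeval_def, MvPolynomial.hom_eval₂,
    ← MvPolynomial.coe_eval₂Hom, MvPolynomial.eval]
  congr 2
  · ext; simp
  · ext i; simp; exact mul_comm _ _

theorem derivative_restrictLine (x y : Fin r → ℝ) (h : MvPolynomial (Fin r) ℝ) :
    (restrictLine x y h).derivative = restrictLine x y (dirDeriv y h) := by
  induction h using MvPolynomial.induction_on with
  | C a => simp [restrictLine, dirDeriv]
  | add p q hp hq =>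
    have e1 : ∀ p q : MvPolynomial (Fin r) ℝ,
      restrictLine x y (p + q) = restrictLine x y p + restrictLine x y q := fun p q => by
        simp [restrictLine]
    have e2 : dirDeriv y (p + q) = dirDeriv y p + dirDeriv y q := by
      simp [dirDeriv, Finset.sum_add_distrib]
    rw [e1, e2, e1, Polynomial.derivative_add, hp, hq]
  | mul_X p n hp =>
    have e2 : dirDeriv y (p * MvPolynomial.X n) =
        dirDeriv y p * MvPolynomial.X n + y n • p := by
      simp only [dirDeriv, Derivation.leibniz, MvPolynomial.pderiv_X, smul_add,
        Finset.sum_add_distrib, Finset.sum_mul]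
      rw [add_comm]
      congr 1
      · refine Finset.sum_congr rfl fun i _ => ?_
        rw [smul_eq_mul, smul_mul_assoc, mul_comm]
      · rw [Finset.sum_eq_single n]
        · simp
        · intro i _ hi
          simp [Pi.single_eq_of_ne hi.symm]
        · simp
    rw [e2]
    simp only [restrictLine, map_mul, map_add, map_smul, MvPolynomial.aeval_X,
      Polynomial.derivative_mul] at hp ⊢
    rw [hp]
    simp [Polynomial.smul_eq_C_mul]
    ring

/-- A univariate polynomial that is bounded on the line is constant. -/
theorem eval_dirDeriv_eq_zero_of_bounded {x y : Fin r → ℝ} {h : MvPolynomial (Fin r) ℝ} {B : ℝ}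
    (hB : ∀ t : ℝ, |MvPolynomial.eval (x + t • y) h| ≤ B) :
    MvPolynomial.eval x (dirDeriv y h) = 0 := by
  have hdeg : (restrictLine x y h).degree ≤ 0 := by
    rw [← Polynomial.isBoundedUnder_abs_atTop_iff]
    refine Filter.isBoundedUnder_of ⟨B, fun t => ?_⟩
    simpa [eval_restrictLine] using hB t
  have h1 := derivative_restrictLine x y h
  rw [Polynomial.eq_C_of_degree_le_zero hdeg, Polynomial.derivative_C] at h1
  have h2 := eval_restrictLine x y (dirDeriv y h) 0
  rw [← h1] at h2
  simpa using h2.symm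

theorem eq_C_of_pderiv_eq_zero {h : MvPolynomial (Fin r) ℝ}
    (hh : ∀ i, MvPolynomial.pderiv i h = 0) : h = MvPolynomial.C (MvPolynomial.eval 0 h) := by
  refine MvPolynomial.funext fun y => ?_
  have h1 := derivative_restrictLine 0 y h
  have h2 : dirDeriv y h = 0 := by simp [dirDeriv, hh]
  rw [h2, show restrictLine 0 y 0 = 0 by simp [restrictLine]] at h1
  have h3 := Polynomial.eq_C_of_derivative_eq_zero h1
  have e0 := eval_restrictLine 0 y h 0
  have e1 := eval_restrictLine 0 y h 1
  rw [h3] at e0 e1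
  simp only [Polynomial.eval_C, zero_smul, add_zero, one_smul, zero_add] at e0 e1
  rw [← e1, e0, MvPolynomial.eval_C]

/-- A polynomial vanishing near the origin along every line vanishes. -/
theorem eq_zero_of_eventually_eval_smul {D : MvPolynomial (Fin r) ℝ}
    (hD : ∀ x : Fin r → ℝ, ∀ᶠ t in nhds (0 : ℝ), MvPolynomial.eval (t • x) D = 0) : D = 0 := by
  refine MvPolynomial.funext fun x => ?_
  have h0 : restrictLine 0 x D = 0 := by
    refine Polynomial.eq_zero_of_infinite_isRoot _ ?_
    refine (infinite_of_mem_nhds (0 : ℝ) (hD x)).mono fun t ht => ?_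
    change (restrictLine 0 x D).eval t = 0
    rw [eval_restrictLine, zero_add]
    exact ht
  have := eval_restrictLine 0 x D 1
  rw [h0] at this
  simpa using this.symm

/-- The quadratic form `(E h)² + E ‖∇ h‖²`. -/
noncomputable def sobolevForm (h : MvPolynomial (Fin r) ℝ) : ℝ :=
  gaussMean r h ^ 2 + ∑ i, gradMoment h i i

theorem sobolevForm_nonneg (h : MvPolynomial (Fin r) ℝ) : 0 ≤ sobolevForm h := by
  unfold sobolevForm
  have : 0 ≤ ∑ i, gradMoment h i i := Finset.sum_nonneg fun i _ => by
    rw [gradMoment_apply, ← sq]; exact gaussMean_sq_nonneg _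
  positivity

/-- Vanishing mean-square partial derivatives make `h` constant, and the vanishing mean kills the
constant. The form is thus positive definite, which later bounds coefficients. -/
theorem eq_zero_of_sobolevForm_eq_zero {h : MvPolynomial (Fin r) ℝ} (hh : sobolevForm h = 0) :
    h = 0 := by
  have hnn : ∀ i, 0 ≤ gradMoment h i i := fun i => by
    rw [gradMoment_apply, ← sq]; exact gaussMean_sq_nonneg _
  have hsum : 0 ≤ ∑ i, gradMoment h i i := Finset.sum_nonneg fun i _ => hnn i
  unfold sobolevForm at hh
  have h1 : gaussMean r h = 0 := by
    have := sq_nonneg (gaussMean r h)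
    exact pow_eq_zero_iff two_ne_zero |>.1 (by linarith)
  have h2 : ∑ i, gradMoment h i i = 0 := by rw [h1] at hh; simpa using hh
  have h3 : ∀ i, MvPolynomial.pderiv i h = 0 := fun i => by
    have := (Finset.sum_eq_zero_iff_of_nonneg fun i _ => hnn i).1 h2 i (Finset.mem_univ i)
    rw [gradMoment_apply, ← sq] at this
    exact gaussMean_sq_eq_zero this
  have h4 := eq_C_of_pderiv_eq_zero h3
  rw [h4] at h1 ⊢
  have : gaussMean r (MvPolynomial.C (MvPolynomial.eval 0 h)) = MvPolynomial.eval 0 h := by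
    simp [gaussMean]
  rw [this] at h1
  rw [h1, map_zero]

theorem sobolevForm_smul (t : ℝ) (h : MvPolynomial (Fin r) ℝ) :
    sobolevForm (t • h) = t ^ 2 * sobolevForm h := by
  simp only [sobolevForm, gradMoment_apply, Derivation.map_smul, map_smul, smul_mul_smul_comm, smul_eq_mul,
    mul_add, Finset.mul_sum]
  congr 1
  · ring
  · refine Finset.sum_congr rfl fun i _ => ?_
    ring

/-- The link polynomials of normalized non-degenerate hidden subspace polynomials. -/
structure IsNormalizedLink (d : ℕ) (α : ℝ) (h : MvPolynomial (Fin r) ℝ) : Prop where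
  mean_eq_zero : gaussMean r h = 0
  nonDegenerate : NonDegenerate α h
  le_one : ((1 : Matrix (Fin r) (Fin r) ℝ) - gradMoment h).PosSemidef
  le_variance : α ≤ d * gaussMean r (h ^ 2)

/-- If the mean square vanished for some direction, `G ⪰ α‖G‖I` would force `G = 0`; with zero mean
this gives `h = 0`, against the variance bound. -/
theorem IsNormalizedLink.gaussMean_dirDeriv_pos {d : ℕ} {α : ℝ} (hα : 0 < α)
    {h : MvPolynomial (Fin r) ℝ} (hh : IsNormalizedLink d α h) {y : Fin r → ℝ} (hy : y ≠ 0) :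
    0 < gaussMean r (dirDeriv y h ^ 2) := by
  refine lt_of_le_of_ne (gaussMean_sq_nonneg _) fun h0 => ?_
  have h1 := hh.nonDegenerate.dotProduct_mulVec_nonneg y
  rw [Matrix.sub_mulVec, dotProduct_sub, star_trivial, dotProduct_gradMoment_mulVec, ← h0,
    Matrix.smul_mulVec, Matrix.one_mulVec, dotProduct_smul, smul_eq_mul] at h1
  have hyy : 0 < y ⬝ᵥ y := by
    have h0 : y ⬝ᵥ y ≠ 0 := fun h => hy (dotProduct_self_eq_zero.1 h)
    exact lt_of_le_of_ne (Finset.sum_nonneg fun i _ => mul_self_nonneg _) h0.symm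
  have hG : gradMoment h = 0 := by
    rw [← norm_eq_zero]
    have h2 : α * ‖gradMoment h‖ * (y ⬝ᵥ y) ≤ 0 := by linarith
    have h3 : 0 ≤ ‖gradMoment h‖ := norm_nonneg _
    by_contra hne
    have : 0 < ‖gradMoment h‖ := lt_of_le_of_ne h3 (Ne.symm hne)
    have := mul_pos (mul_pos hα this) hyy
    linarith
  have hz : h = 0 := eq_zero_of_sobolevForm_eq_zero (by
    simp [sobolevForm, hG, hh.mean_eq_zero])
  have := hh.le_variance
  rw [hz] at this
  simp at this
  linarith

/-- On a slab given by fewer than `r` vectors, a non-degenerate polynomial is unbounded. -/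
theorem IsNormalizedLink.exists_mem_slab {d : ℕ} {α : ℝ} (hα : 0 < α)
    {h : MvPolynomial (Fin r) ℝ} (hh : IsNormalizedLink d α h) {ℓ : ℕ} (hℓ : ℓ < r)
    (v : Fin ℓ → EuclideanSpace ℝ (Fin r)) (τ : ℝ) :
    ∃ y : EuclideanSpace ℝ (Fin r), τ < |MvPolynomial.eval (fun k => y k) h| ∧
      ∀ i, |(inner ℝ (v i) y : ℝ)| < 1 / 2 := by
  by_contra! hcon
  -- Since `ℓ < r`, some nonzero direction is orthogonal to all normals, and the slab contains full
  -- lines in that direction.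
  obtain ⟨y, hy, hy0⟩ : ∃ y ∈ (Submodule.span ℝ (Set.range v))ᗮ, y ≠ 0 := by
    rw [← Submodule.ne_bot_iff]
    intro hbot
    have h1 := (Submodule.span ℝ (Set.range v)).finrank_add_finrank_orthogonal
    rw [hbot, finrank_bot, finrank_euclideanSpace_fin] at h1
    have h2 := finrank_range_le_card (R := ℝ) v
    rw [Set.finrank, Fintype.card_fin] at h2
    omega
  have hvy : ∀ i, (inner ℝ (v i) y : ℝ) = 0 := fun i =>
    (Submodule.mem_orthogonal _ _).1 hy _ (Submodule.subset_span ⟨i, rfl⟩)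
  -- On each such line `|h| ≤ τ`, so the derivative along `y` vanishes on the whole slab. The slab
  -- is a neighbourhood of the origin, so this derivative vanishes identically.
  have hbound : ∀ x : EuclideanSpace ℝ (Fin r), (∀ i, |(inner ℝ (v i) x : ℝ)| < 1 / 2) →
      MvPolynomial.eval (fun k => x k) (dirDeriv (fun k => y k) h) = 0 := by
    intro x hx
    refine eval_dirDeriv_eq_zero_of_bounded (B := τ) fun t => ?_
    by_contra! hgt
    obtain ⟨i, hi⟩ := hcon (x + t • y) (by simpa [Pi.add_def, Pi.smul_def] using hgt)
    rw [inner_add_right, real_inner_smul_right, hvy, mul_zero, add_zero] at hi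
    exact absurd (hx i) (not_lt.2 hi)
  have hD : dirDeriv (fun k => y k) h = 0 := by
    refine eq_zero_of_eventually_eval_smul fun x => ?_
    have : ∀ᶠ t in nhds (0 : ℝ), ∀ i,
        |(inner ℝ (v i) (t • (WithLp.toLp 2 x : EuclideanSpace ℝ (Fin r))) : ℝ)| < 1 / 2 := by
      rw [Filter.eventually_all]
      intro i
      have hc : Continuous fun t : ℝ =>
        |(inner ℝ (v i) (t • (WithLp.toLp 2 x : EuclideanSpace ℝ (Fin r))) : ℝ)| := by fun_prop
      have := hc.tendsto 0
      simp only [zero_smul, inner_zero_right, abs_zero] at this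
      exact this.eventually (gt_mem_nhds (by norm_num))
    filter_upwards [this] with t ht
    have := hbound _ ht
    simpa [Pi.smul_def] using this
  have := hh.gaussMean_dirDeriv_pos hα (y := fun k => y k) (fun h0 => hy0 (by
    ext k; exact congrFun h0 k))
  rw [hD] at this
  simp at this

/-! ### Compactness of the set of normalized links -/

section Compactness

variable {k : ℕ} (L : (Fin k → ℝ) →ₗ[ℝ] MvPolynomial (Fin r) ℝ)

/-- The expression is a quadratic form in the coordinates `c`. Entries of `gradMoment` and variances
are of this shape, so the conditions on a link are closed. -/
theorem continuous_linear_mul_linear (I : MvPolynomial (Fin r) ℝ →ₗ[ℝ] ℝ)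
    (A B : (Fin k → ℝ) →ₗ[ℝ] MvPolynomial (Fin r) ℝ) : Continuous fun c => I (A c * B c) := by
  have : ∀ c, I (A c * B c) = ∑ a, ∑ b, c a * c b *
      I (A (Pi.single a 1) * B (Pi.single b 1)) := by
    intro c
    conv_lhs => rw [LinearMap.pi_apply_eq_sum_univ A c, LinearMap.pi_apply_eq_sum_univ B c,
      Finset.sum_mul_sum]
    simp only [map_sum, smul_mul_smul_comm, map_smul, smul_eq_mul]
    refine Finset.sum_congr rfl fun a _ => Finset.sum_congr rfl fun b _ => ?_
    congr 4 <;> · ext i; simp [Pi.single_apply, eq_comm]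
  simp_rw [this]
  fun_prop

theorem continuous_eval_linear :
    Continuous fun p : (Fin k → ℝ) × EuclideanSpace ℝ (Fin r) =>
      MvPolynomial.eval (fun i => p.2 i) (L p.1) := by
  have : ∀ p : (Fin k → ℝ) × EuclideanSpace ℝ (Fin r),
      MvPolynomial.eval (fun i => p.2 i) (L p.1) =
        ∑ a, p.1 a * MvPolynomial.eval (fun i => p.2 i) (L fun j => if a = j then 1 else 0) := by
    intro p
    conv_lhs => rw [LinearMap.pi_apply_eq_sum_univ L p.1]
    simp [MvPolynomial.smul_eval]
  simp_rw [this]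
  refine continuous_finsetSum _ fun a _ => ?_
  exact ((continuous_apply a).comp continuous_fst).mul
    ((continuous_eval_euclidean _).comp continuous_snd)

theorem continuous_gradMoment_linear : Continuous fun c => gradMoment (L c) := by
  refine continuous_matrix fun i j => ?_
  simp_rw [gradMoment_apply]
  exact continuous_linear_mul_linear (gaussMean r)
    ((MvPolynomial.pderiv i).toLinearMap.comp L) ((MvPolynomial.pderiv j).toLinearMap.comp L)

theorem continuous_gaussMean_linear : Continuous fun c => gaussMean r (L c) :=
  ((gaussMean r).comp L).continuous_of_finiteDimensional

theorem isClosed_setOf_posSemidef {X : Type*} [TopologicalSpace X]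
    {A : X → Matrix (Fin r) (Fin r) ℝ} (hA : Continuous A) (hH : ∀ c, (A c).IsHermitian) :
    IsClosed {c | (A c).PosSemidef} := by
  have : {c | (A c).PosSemidef} = ⋂ x : Fin r → ℝ, {c | 0 ≤ x ⬝ᵥ (A c).mulVec x} := by
    ext c
    simp only [Set.mem_ofPred_eq, Set.mem_iInter, Matrix.posSemidef_iff_dotProduct_mulVec, hH c,
      true_and, star_trivial]
  rw [this]
  exact isClosed_iInter fun x => isClosed_le continuous_const (by fun_prop)

theorem isClosed_setOf_isNormalizedLink (d : ℕ) (α : ℝ) :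
    IsClosed {c | IsNormalizedLink d α (L c)} := by
  have hG := continuous_gradMoment_linear L
  have h1 : IsClosed {c | gaussMean r (L c) = 0} :=
    isClosed_eq (continuous_gaussMean_linear L) continuous_const
  have h2 : IsClosed {c | NonDegenerate α (L c)} := by
    refine isClosed_setOf_posSemidef (by fun_prop) fun c => ?_
    refine (gradMoment_isHermitian _).sub ?_
    simp [Matrix.IsHermitian]
  have h3 : IsClosed {c | ((1 : Matrix (Fin r) (Fin r) ℝ) - gradMoment (L c)).PosSemidef} :=
    isClosed_setOf_posSemidef (by fun_prop)
      fun c => Matrix.isHermitian_one.sub (gradMoment_isHermitian _)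
  have h4 : IsClosed {c | α ≤ d * gaussMean r (L c ^ 2)} := by
    simp_rw [sq]
    exact isClosed_le continuous_const
      (continuous_const.mul (continuous_linear_mul_linear (gaussMean r) L L))
  have : {c | IsNormalizedLink d α (L c)} = {c | gaussMean r (L c) = 0} ∩
      {c | NonDegenerate α (L c)} ∩
      {c | ((1 : Matrix (Fin r) (Fin r) ℝ) - gradMoment (L c)).PosSemidef} ∩
      {c | α ≤ d * gaussMean r (L c ^ 2)} := by
    ext c
    exact ⟨fun h => ⟨⟨⟨h.1, h.2⟩, h.3⟩, h.4⟩, fun h => ⟨h.1.1.1, h.1.1.2, h.1.2, h.2⟩⟩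
  rw [this]
  exact ((h1.inter h2).inter h3).inter h4

theorem IsNormalizedLink.sobolevForm_le {d : ℕ} {α : ℝ} {h : MvPolynomial (Fin r) ℝ}
    (hh : IsNormalizedLink d α h) : sobolevForm h ≤ r := by
  have h1 : ∀ i, gradMoment h i i ≤ 1 := fun i => by
    have := hh.le_one.diag_nonneg (i := i)
    simpa using this
  have h2 : ∑ i, gradMoment h i i ≤ ∑ _i : Fin r, (1 : ℝ) := Finset.sum_le_sum fun i _ => h1 i
  simp only [sobolevForm, hh.mean_eq_zero]
  simpa using h2

variable {L} in
-- Boundedness: as `L` is injective, `sobolevForm` is positive definite in the coordinates, so it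
-- dominates `‖c‖²` times its minimum on the unit sphere, while on normalized links it is at most
-- `r`, since `G ⪯ I`.
theorem isCompact_setOf_isNormalizedLink (hL : Function.Injective L) (d : ℕ) (α : ℝ) :
    IsCompact {c | IsNormalizedLink d α (L c)} := by
  refine Metric.isCompact_of_isClosed_isBounded (isClosed_setOf_isNormalizedLink L d α) ?_
  have hq : Continuous fun c => sobolevForm (L c) := by
    unfold sobolevForm
    have hG := continuous_gradMoment_linear L
    have hm := continuous_gaussMean_linear L
    exact (hm.pow 2).add (continuous_finsetSum _ fun i _ => hG.matrix_elem i i)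
  rcases (Metric.sphere (0 : Fin k → ℝ) 1).eq_empty_or_nonempty with hS | hS
  -- An empty unit sphere means that the coordinate space is trivial.
  · refine (Metric.isBounded_closedBall (x := (0 : Fin k → ℝ)) (r := 0)).subset fun c _ => ?_
    rw [mem_closedBall_zero_iff]
    by_contra! hc
    have : ‖c‖⁻¹ • c ∈ Metric.sphere (0 : Fin k → ℝ) 1 := by
      rw [mem_sphere_zero_iff_norm, norm_smul, norm_inv, norm_norm, inv_mul_cancel₀ hc.ne']
    rw [hS] at this
    exact this
  · obtain ⟨c₀, hc₀, hmin⟩ := (isCompact_sphere (0 : Fin k → ℝ) 1).exists_isMinOn hS hq.continuousOn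
    have hm : 0 < sobolevForm (L c₀) := by
      refine lt_of_le_of_ne (sobolevForm_nonneg _) fun h0 => ?_
      have h1 : c₀ = 0 := hL (by rw [eq_zero_of_sobolevForm_eq_zero h0.symm, map_zero])
      rw [h1, mem_sphere_zero_iff_norm, norm_zero] at hc₀
      exact zero_ne_one hc₀
    refine (Metric.isBounded_closedBall (x := (0 : Fin k → ℝ))
      (r := √(r / sobolevForm (L c₀)))).subset fun c hc => ?_
    rw [mem_closedBall_zero_iff]
    apply Real.le_sqrt_of_sq_le
    rw [le_div_iff₀ hm]
    refine le_trans ?_ (IsNormalizedLink.sobolevForm_le hc)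
    by_cases hc0 : c = 0
    · simpa [hc0] using sobolevForm_nonneg _
    have hn : ‖c‖ ≠ 0 := norm_ne_zero_iff.2 hc0
    have hmem : ‖c‖⁻¹ • c ∈ Metric.sphere (0 : Fin k → ℝ) 1 := by
      rw [mem_sphere_zero_iff_norm, norm_smul, norm_inv, norm_norm, inv_mul_cancel₀ hn]
    have h1 := hmin hmem
    simp only [map_smul, sobolevForm_smul, Set.mem_ofPred_eq] at h1
    calc ‖c‖ ^ 2 * sobolevForm (L c₀) ≤ ‖c‖ ^ 2 * ((‖c‖⁻¹) ^ 2 * sobolevForm (L c)) := by gcongr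
      _ = sobolevForm (L c) := by field_simp

variable {L} in
-- The values are jointly continuous on the compact product of links and the ball of radius `R`; `τ`
-- is a bound for them there.
theorem exists_threshold (hL : Function.Injective L) (d : ℕ) (α R : ℝ) :
    ∃ τ, 0 < τ ∧ ∀ c, IsNormalizedLink d α (L c) → ∀ y : EuclideanSpace ℝ (Fin r),
      τ < |MvPolynomial.eval (fun i => y i) (L c)| → R < ‖y‖ := by
  obtain ⟨C, hC⟩ := ((isCompact_setOf_isNormalizedLink hL d α).prod
    (isCompact_closedBall (0 : EuclideanSpace ℝ (Fin r)) R)).exists_bound_of_continuousOn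
    (continuous_eval_linear L).continuousOn
  refine ⟨max C 1, by positivity, fun c hc y hy => ?_⟩
  by_contra! hyR
  have := hC (c, y) ⟨hc, by simpa using hyR⟩
  rw [Real.norm_eq_abs] at this
  exact absurd (hy.trans_le this) (not_lt.2 (le_max_left _ _))

variable {L} in
-- Only a local lower bound on the probability is needed. The event is open jointly in parameters
-- and point, so around each parameter an open box fits inside it, and the mass of the box's spatial
-- side works for all nearby parameters. Half-width `1/2` instead of `1` leaves room for replacing
-- the normals by their projections to `U`.
theorem exists_slab_tail_lower_bound (hL : Function.Injective L) (d : ℕ) {α : ℝ} (hα : 0 < α)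
    (τ : ℝ) {ℓ : ℕ} (hℓ : ℓ < r) :
    ∃ c₀ : ENNReal, 0 < c₀ ∧ ∀ c, IsNormalizedLink d α (L c) →
      ∀ v : Fin ℓ → EuclideanSpace ℝ (Fin r), (∀ i, ‖v i‖ ≤ 1) →
        c₀ ≤ stdGaussian (EuclideanSpace ℝ (Fin r))
          {y | τ < |MvPolynomial.eval (fun i => y i) (L c)| ∧
            ∀ i, |(inner ℝ (v i) y : ℝ)| < 1 / 2} := by
  set O : ((Fin k → ℝ) × (Fin ℓ → EuclideanSpace ℝ (Fin r))) →
      Set (EuclideanSpace ℝ (Fin r)) := fun p =>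
    {y | τ < |MvPolynomial.eval (fun i => y i) (L p.1)| ∧
      ∀ i, |(inner ℝ (p.2 i) y : ℝ)| < 1 / 2} with hO
  have hopen : IsOpen {z : ((Fin k → ℝ) × (Fin ℓ → EuclideanSpace ℝ (Fin r))) ×
      EuclideanSpace ℝ (Fin r) | z.2 ∈ O z.1} := by
    have h1 := (continuous_eval_linear L).comp (show Continuous
      fun z : ((Fin k → ℝ) × (Fin ℓ → EuclideanSpace ℝ (Fin r))) × EuclideanSpace ℝ (Fin r) =>
        (z.1.1, z.2) by fun_prop)
    have h2 : ∀ i, IsOpen {z : ((Fin k → ℝ) × (Fin ℓ → EuclideanSpace ℝ (Fin r))) ×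
        EuclideanSpace ℝ (Fin r) | |(inner ℝ (z.1.2 i) z.2 : ℝ)| < 1 / 2} := fun i =>
      isOpen_lt (by fun_prop) continuous_const
    have h3 := (isOpen_lt (continuous_const (y := τ)) h1.abs).inter (isOpen_iInter_of_finite h2)
    convert h3 using 1
    ext z
    simp only [hO, Set.mem_ofPred_eq, Set.mem_inter_iff, Set.mem_iInter, Function.comp_apply]
  set K : Set ((Fin k → ℝ) × (Fin ℓ → EuclideanSpace ℝ (Fin r))) :=
    {c | IsNormalizedLink d α (L c)} ×ˢ
      Set.univ.pi fun _ => Metric.closedBall (0 : EuclideanSpace ℝ (Fin r)) 1 with hK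
  have hKc : IsCompact K := (isCompact_setOf_isNormalizedLink hL d α).prod
    (isCompact_univ_pi fun _ => isCompact_closedBall _ _)
  have hmain : ∃ c₀ : ENNReal, 0 < c₀ ∧ ∀ p ∈ K,
      c₀ ≤ stdGaussian (EuclideanSpace ℝ (Fin r)) (O p) := by
    refine hKc.induction_on (p := fun s => ∃ c₀ : ENNReal, 0 < c₀ ∧ ∀ p ∈ s,
      c₀ ≤ stdGaussian (EuclideanSpace ℝ (Fin r)) (O p)) ⟨1, one_pos, by simp⟩
      (fun s t hst ⟨c, hc, hct⟩ => ⟨c, hc, fun p hp => hct p (hst hp)⟩)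
      (fun s t ⟨c, hc, hcs⟩ ⟨c', hc', hct⟩ => ⟨min c c', lt_min hc hc', fun p hp => ?_⟩)
      (fun p hp => ?_)
    · rcases hp with hp | hp
      · exact (min_le_left _ _).trans (hcs p hp)
      · exact (min_le_right _ _).trans (hct p hp)
    · obtain ⟨y, hy⟩ := hp.1.exists_mem_slab hα hℓ p.2 τ
      obtain ⟨s, t, hs, ht, hps, hyt, hst⟩ := isOpen_prod_iff.1 hopen p y hy
      refine ⟨s, mem_nhdsWithin_of_mem_nhds (hs.mem_nhds hps),
        stdGaussian (EuclideanSpace ℝ (Fin r)) t, ht.measure_pos _ ⟨y, hyt⟩,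
        fun q hq => ?_⟩
      have hsub : t ⊆ O q := fun z hz => by
        have : (q, z) ∈ {z : ((Fin k → ℝ) × (Fin ℓ → EuclideanSpace ℝ (Fin r))) ×
          EuclideanSpace ℝ (Fin r) | z.2 ∈ O z.1} := hst (Set.mk_mem_prod hq hz)
        rwa [Set.mem_ofPred_eq] at this
      exact measure_mono hsub
  obtain ⟨c₀, hc₀, h⟩ := hmain
  refine ⟨c₀, hc₀, fun c hc v hv => ?_⟩
  have hmem : (c, v) ∈ K :=
    Set.mk_mem_prod hc (Set.mem_univ_pi.2 fun i => mem_closedBall_zero_iff.2 (hv i))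
  have := h (c, v) hmem
  simpa only [hO] using this

end Compactness

/-- Uniform threshold and uniform tail probability in slabs for normalized link polynomials. -/
theorem exists_uniform_threshold_and_tail (r d : ℕ) {α : ℝ} (hα : 0 < α) (R : ℝ) :
    ∃ τ c₀ : ℝ, 0 < τ ∧ 0 < c₀ ∧ ∀ h : MvPolynomial (Fin r) ℝ, h.totalDegree ≤ d →
      IsNormalizedLink d α h →
      (∀ y : EuclideanSpace ℝ (Fin r),
        τ < |MvPolynomial.eval (fun i => y i) h| → R < ‖y‖) ∧
      ∀ ℓ < r, ∀ v : Fin ℓ → EuclideanSpace ℝ (Fin r), (∀ i, ‖v i‖ ≤ 1) →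
        c₀ ≤ (stdGaussian (EuclideanSpace ℝ (Fin r))).real
          {y | τ < |MvPolynomial.eval (fun i => y i) h| ∧
            ∀ i, |(inner ℝ (v i) y : ℝ)| < 1 / 2} := by
  set V := MvPolynomial.restrictTotalDegree (Fin r) ℝ d
  set e := (Module.finBasis ℝ V).equivFun
  set L := V.subtype.comp e.symm.toLinearMap with hLdef
  have hL : Function.Injective L := V.subtype_injective.comp e.symm.injective
  have hsurj : ∀ h : MvPolynomial (Fin r) ℝ, h.totalDegree ≤ d → ∃ c, L c = h := fun h hh =>
    ⟨e ⟨h, (MvPolynomial.mem_restrictTotalDegree _ _ _).2 hh⟩, by simp [L]⟩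
  obtain ⟨τ, hτ, hthr⟩ := exists_threshold hL d α R
  have htail := fun ℓ (hℓ : ℓ < r) => exists_slab_tail_lower_bound hL d hα τ hℓ
  choose! g hg hgb using htail
  -- The minimum with `1` keeps the constant finite; for `r = 0` the infimum is `⊤`.
  set c := min 1 ((Finset.range r).inf g) with hc
  have hcpos : 0 < c := by
    refine lt_min one_pos ?_
    rw [Finset.lt_inf_iff ENNReal.zero_lt_top]
    exact fun ℓ hℓ => hg ℓ (Finset.mem_range.1 hℓ)
  have hctop : c ≠ ⊤ := ne_top_of_le_ne_top ENNReal.one_ne_top (min_le_left _ _)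
  refine ⟨τ, c.toReal, hτ, ENNReal.toReal_pos hcpos.ne' hctop, fun h hh hN => ?_⟩
  obtain ⟨a, rfl⟩ := hsurj h hh
  refine ⟨hthr a hN, fun ℓ hℓ v hv => ?_⟩
  refine ENNReal.toReal_mono (measure_ne_top _ _) (le_trans ?_ (hgb ℓ hℓ a hN v hv))
  exact (min_le_right _ _).trans (Finset.inf_le (Finset.mem_range.2 hℓ))

end PolynomialClass

/-! ### The top eigenvalue of a possibly non-symmetric perturbation -/

section TopEigenvalue

/-- A matrix all of whose complex eigenvalues have modulus `< 1` has powers tending to zero. -/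
theorem tendsto_pow_of_forall_spectrum_norm_lt_one {n : ℕ} (T : Matrix (Fin n) (Fin n) ℂ)
    (hT : ∀ z ∈ spectrum ℂ T, ‖z‖ < 1) :
    Filter.Tendsto (fun k : ℕ => T ^ k) Filter.atTop (nhds 0) := by
  rcases isEmpty_or_nonempty (Fin n) with hn | hn
  · exact tendsto_const_nhds.congr fun k => Subsingleton.elim _ _
  have hr : spectralRadius ℂ T < 1 := by
    refine spectrum.spectralRadius_lt_of_forall_lt T (r := 1) fun z hz => ?_
    have := hT z hz
    exact_mod_cast this
  obtain ⟨a, ha, ha1⟩ := exists_between hr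
  have h := (spectrum.pow_nnnorm_pow_one_div_tendsto_nhds_spectralRadius T).eventually
    (gt_mem_nhds ha)
  have ha' : Filter.Tendsto (fun k : ℕ => a ^ k) Filter.atTop (nhds 0) :=
    ENNReal.tendsto_pow_atTop_nhds_zero_of_lt_one ha1
  rw [tendsto_zero_iff_enorm_tendsto_zero]
  refine tendsto_of_tendsto_of_tendsto_of_le_of_le' tendsto_const_nhds ha'
    (Filter.Eventually.of_forall fun _ => zero_le) ?_
  filter_upwards [h, Filter.eventually_gt_atTop 0] with k hk hk0
  have hk0' : (0 : ℝ) < k := by exact_mod_cast hk0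
  have := ENNReal.rpow_le_rpow hk.le hk0'.le
  rw [← ENNReal.rpow_mul] at this
  simpa [hk0'.ne', enorm] using this

/-- If all complex eigenvalues of the real matrix `N` lie in the open left half plane, then the
iterated Euler steps `(1 + ε N) ^ k` with small `ε` tend to zero. -/
theorem exists_tendsto_one_add_smul_pow {n : ℕ} (N : Matrix (Fin n) (Fin n) ℝ) {η ε₀ : ℝ}
    (hη : 0 < η) (hε₀ : 0 < ε₀)
    (hN : ∀ z ∈ spectrum ℂ (N.map (fun a : ℝ => (a : ℂ))), z.re ≤ -η) :
    ∃ ε : ℝ, 0 < ε ∧ ε ≤ ε₀ ∧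
      Filter.Tendsto (fun k : ℕ => (1 + ε • N) ^ k) Filter.atTop (nhds 0) := by
  set Nc := N.map (fun a : ℝ => (a : ℂ)) with hNc
  have hb := spectrum.isBounded (𝕜 := ℂ) Nc
  obtain ⟨R, hR, hbR⟩ := hb.exists_pos_norm_le
  -- For an eigenvalue `c` of `N`, `|1 + εc|² ≤ 1 - 2εη + ε²R²`, which is below `1` once `εR² ≤ η`.
  refine ⟨min ε₀ (η / R ^ 2), by positivity, min_le_left _ _, ?_⟩
  set ε := min ε₀ (η / R ^ 2) with hε
  have hεpos : 0 < ε := by positivity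
  have hεR : ε * R ^ 2 ≤ η := by
    calc ε * R ^ 2 ≤ η / R ^ 2 * R ^ 2 := by gcongr; exact min_le_right _ _
      _ = η := by field_simp
  have hTc : Filter.Tendsto (fun k : ℕ => (1 + (ε : ℂ) • Nc) ^ k) Filter.atTop (nhds 0) := by
    apply tendsto_pow_of_forall_spectrum_norm_lt_one
    intro z hz
    have hmem : (z - 1) / ε ∈ spectrum ℂ Nc := by
      rw [show (1 : Matrix (Fin n) (Fin n) ℂ) = algebraMap ℂ _ 1 by simp,
        ← spectrum.singleton_add_eq] at hz
      obtain ⟨a, ha, b, hb, rfl⟩ := hz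
      have hε0 : (ε : ℂ) ≠ 0 := by exact_mod_cast hεpos.ne'
      rw [show (ε : ℂ) • Nc = (Units.mk0 (ε : ℂ) hε0) • Nc from rfl, spectrum.unit_smul_eq_smul] at hb
      obtain ⟨c, hc, rfl⟩ := hb
      simp only [Set.mem_singleton_iff] at ha
      subst ha
      simpa [Units.smul_def, hε0] using hc
    set c := (z - 1) / ε with hc
    have hz : z = 1 + ε * c := by
      have hε0 : (ε : ℂ) ≠ 0 := by exact_mod_cast hεpos.ne'
      rw [hc]; field_simp; ring
    have h1 := hN c hmem
    have h2 := hbR c hmem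
    have h3 : ‖c‖ ^ 2 ≤ R ^ 2 := by gcongr
    have h4 : ‖z‖ ^ 2 = 1 + 2 * ε * c.re + ε ^ 2 * ‖c‖ ^ 2 := by
      rw [← Complex.normSq_eq_norm_sq, ← Complex.normSq_eq_norm_sq, hz, Complex.normSq_apply,
        Complex.normSq_apply]
      simp
      ring
    have h5 : ‖z‖ ^ 2 < 1 := by
      rw [h4]
      nlinarith [mul_le_mul_of_nonneg_left h3 (sq_nonneg ε), mul_le_mul_of_nonneg_left h1 hεpos.le,
        mul_le_mul_of_nonneg_left hεR hεpos.le, mul_pos hεpos hη]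
    nlinarith [norm_nonneg z]
  refine tendsto_pi_nhds.2 fun i => tendsto_pi_nhds.2 fun j => ?_
  have hij := (tendsto_pi_nhds.1 ((tendsto_pi_nhds.1 hTc) i)) j
  have hre := (Complex.continuous_re.tendsto _).comp hij
  have hmap : ∀ k : ℕ, (1 + (ε : ℂ) • Nc) ^ k = ((1 + ε • N) ^ k).map (algebraMap ℝ ℂ) := by
    intro k
    rw [← RingHom.mapMatrix_apply, map_pow, map_add, map_one]
    congr 2
    ext a b
    simp [Nc]
  refine Filter.Tendsto.congr (fun k => ?_) (by simpa using hre)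
  change (((1 + (ε : ℂ) • Nc) ^ k) i j).re = _
  rw [hmap]
  simp

/-- Pigeonhole: `m + 1` disjoint windows of half-width `lam / (4 (m + 1))` fit in `(lam/2, lam)`,
and at most `m` values are nonzero, so one window is free of values. -/
theorem exists_gap_of_card_ne_zero_le {ι : Type*} [Fintype ι] (f : ι → ℝ) {m : ℕ}
    (hm : Fintype.card {i // f i ≠ 0} ≤ m) {lam : ℝ} (hlam : 0 < lam) :
    ∃ t, lam / 2 < t ∧ t < lam ∧ ∀ i, lam / (4 * (m + 1)) ≤ |f i - t| := by
  set w := lam / (4 * (m + 1)) with hw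
  have hwpos : 0 < w := by positivity
  have hwm : w * (4 * (m + 1)) = lam := by rw [hw]; field_simp
  have hk : ∀ k : Fin (m + 1), (k : ℝ) ≤ m := fun k => by
    exact_mod_cast Nat.lt_succ_iff.1 k.2
  by_contra! hcon
  have hex : ∀ k : Fin (m + 1), ∃ i, |f i - (lam / 2 + (2 * k + 1) * w)| < w := by
    intro k
    refine hcon _ ?_ ?_
    · have : 0 < (2 * (k : ℝ) + 1) * w := by positivity
      linarith
    · nlinarith [hk k]
  choose g hg using hex
  have hg0 : ∀ k, f (g k) ≠ 0 := by
    intro k h0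
    have := (abs_lt.1 (hg k)).1
    rw [h0] at this
    have : 0 ≤ 2 * (k : ℝ) * w := by positivity
    nlinarith
  have hinj : Function.Injective fun k => (⟨g k, hg0 k⟩ : {i // f i ≠ 0}) := by
    intro a b hab
    have hab' : g a = g b := congrArg Subtype.val hab
    have h1 := abs_lt.1 (hg a)
    have h2 := abs_lt.1 (hg b)
    rw [hab'] at h1
    have h3 : (a : ℝ) < b + 1 := by
      by_contra! h
      nlinarith
    have h4 : (b : ℝ) < a + 1 := by
      by_contra! h
      nlinarith
    have h3' : (a : ℕ) < b + 1 := by exact_mod_cast h3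
    have h4' : (b : ℕ) < a + 1 := by exact_mod_cast h4
    exact Fin.ext (by omega)
  have := Fintype.card_le_of_injective _ hinj
  simp only [Fintype.card_fin] at this
  omega

/-- `N` is `diag(s) + F` in the basis `b`. The first-order change of the form under `1 + εN` is at
least `2ε(w - ρ)‖x‖²`, because the signs turn each `s i` into `|s i| ≥ w`; the second-order loss is
at most `ε²‖N‖²‖x‖²`. -/
theorem sum_sign_mul_sq_le_of_step {ι E : Type*} [Fintype ι] [NormedAddCommGroup E]
    [InnerProductSpace ℝ E] (b : OrthonormalBasis ι ℝ E) (s : ι → ℝ) (F N : E →L[ℝ] E)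
    (hN : ∀ i x, (inner ℝ (b i) (N x) : ℝ) = s i * inner ℝ (b i) x + inner ℝ (b i) (F x))
    {w ρ ε : ℝ} (hF : ‖F‖ ≤ ρ) (hs : ∀ i, w ≤ |s i|) (hε : 0 ≤ ε)
    (hεN : ε * ‖N‖ ^ 2 ≤ 2 * (w - ρ)) (x : E) :
    ∑ i, SignType.sign (s i) * (inner ℝ (b i) x : ℝ) ^ 2 ≤
      ∑ i, SignType.sign (s i) * (inner ℝ (b i) (x + ε • N x) : ℝ) ^ 2 := by
  have hsgn : ∀ i, |((SignType.sign (s i) : SignType) : ℝ)| ≤ 1 := by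
    intro i
    rcases SignType.trichotomy (SignType.sign (s i)) with h | h | h <;> simp [h]
  have h1 : w * ‖x‖ ^ 2 ≤ ∑ i, SignType.sign (s i) * (s i * (inner ℝ (b i) x : ℝ) ^ 2) := by
    rw [← b.sum_sq_inner_right x, Finset.mul_sum]
    refine Finset.sum_le_sum fun i _ => ?_
    rw [← mul_assoc, sign_mul_self]
    gcongr
    exact hs i
  have h2 : -(ρ * ‖x‖ ^ 2) ≤
      ∑ i, SignType.sign (s i) * ((inner ℝ (b i) x : ℝ) * inner ℝ (b i) (F x)) := by
    have hFx : ‖F x‖ ≤ ρ * ‖x‖ := (F.le_opNorm x).trans (by gcongr)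
    have hcs : ∑ i, |(inner ℝ (b i) x : ℝ)| * |(inner ℝ (b i) (F x) : ℝ)| ≤ ‖x‖ * ‖F x‖ := by
      have := Real.sum_mul_le_sqrt_mul_sqrt Finset.univ (fun i => |(inner ℝ (b i) x : ℝ)|)
        (fun i => |(inner ℝ (b i) (F x) : ℝ)|)
      simpa [sq_abs, b.sum_sq_inner_right] using this
    have habs : |∑ i, SignType.sign (s i) * ((inner ℝ (b i) x : ℝ) * inner ℝ (b i) (F x))| ≤
        ∑ i, |(inner ℝ (b i) x : ℝ)| * |(inner ℝ (b i) (F x) : ℝ)| := by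
      refine (Finset.abs_sum_le_sum_abs _ _).trans (Finset.sum_le_sum fun i _ => ?_)
      rw [abs_mul, abs_mul]
      exact mul_le_of_le_one_left (by positivity) (hsgn i)
    have := neg_le_of_abs_le (habs.trans hcs)
    nlinarith [norm_nonneg x, mul_le_mul_of_nonneg_left hFx (norm_nonneg x)]
  have h3 : -(‖N‖ ^ 2 * ‖x‖ ^ 2) ≤ ∑ i, SignType.sign (s i) * (inner ℝ (b i) (N x) : ℝ) ^ 2 := by
    have hNx : ‖N x‖ ^ 2 ≤ ‖N‖ ^ 2 * ‖x‖ ^ 2 := by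
      rw [← mul_pow]; gcongr; exact N.le_opNorm x
    rw [← b.sum_sq_inner_right (N x)] at hNx
    refine le_trans (neg_le_neg hNx) ?_
    rw [← Finset.sum_neg_distrib]
    refine Finset.sum_le_sum fun i _ => ?_
    nlinarith [neg_le_of_abs_le (hsgn i), sq_nonneg (inner ℝ (b i) (N x) : ℝ)]
  have h4 : ∑ i, SignType.sign (s i) * (inner ℝ (b i) (x + ε • N x) : ℝ) ^ 2 =
      ∑ i, SignType.sign (s i) * (inner ℝ (b i) x : ℝ) ^ 2 +
      2 * ε * (∑ i, SignType.sign (s i) * (s i * (inner ℝ (b i) x : ℝ) ^ 2) +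
        ∑ i, SignType.sign (s i) * ((inner ℝ (b i) x : ℝ) * inner ℝ (b i) (F x))) +
      ε ^ 2 * ∑ i, SignType.sign (s i) * (inner ℝ (b i) (N x) : ℝ) ^ 2 := by
    rw [← Finset.sum_add_distrib, Finset.mul_sum, Finset.mul_sum, ← Finset.sum_add_distrib,
      ← Finset.sum_add_distrib]
    refine Finset.sum_congr rfl fun i _ => ?_
    rw [inner_add_right, real_inner_smul_right]
    have := hN i x
    linear_combination (2 * ε * SignType.sign (s i) * inner ℝ (b i) x) * this
  rw [h4]
  have h5 : 0 ≤ 2 * ε * ((w - ρ) * ‖x‖ ^ 2) - ε ^ 2 * (‖N‖ ^ 2 * ‖x‖ ^ 2) := by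
    have := mul_le_mul_of_nonneg_left hεN (mul_nonneg hε (sq_nonneg ‖x‖))
    linarith
  have h6 := mul_le_mul_of_nonneg_left (add_le_add h1 h2) (by positivity : 0 ≤ 2 * ε)
  have h7 := mul_le_mul_of_nonneg_left h3 (sq_nonneg ε)
  linarith

/-- A perturbation `M` of a symmetric matrix `A` of rank at most `m`, small compared to
`lam / (4 (m + 1))`, keeps an eigenvalue with real part at least `lam / 2` if `A` has a direction
of quadratic form at least `lam`. -/
theorem half_le_of_spectrum_re_le {n m : ℕ} {A M : Matrix (Fin n) (Fin n) ℝ} (hA : A.IsHermitian)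
    (hm : A.rank ≤ m) {lam ρ μ : ℝ} (hlam : 0 < lam) (hρ : ‖M - A‖ ≤ ρ)
    (hρlam : ρ < lam / (4 * (m + 1))) {z : EuclideanSpace ℝ (Fin n)} (hz : ‖z‖ = 1)
    (hzA : lam ≤ inner ℝ z (Matrix.toEuclideanCLM (n := Fin n) (𝕜 := ℝ) A z))
    (hμ : ∀ c ∈ spectrum ℂ (M.map (fun a : ℝ => (a : ℂ))), c.re ≤ μ) : lam / 2 ≤ μ := by
  by_contra! hcon
  -- As `μ < lam/2 < t`, the spectrum of `M - t` lies in the open left half plane and its Euler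
  -- iterates tend to zero. The form `H` below never decreases along them and equals `1` at an
  -- eigenvector of `A` with eigenvalue above `t`: a contradiction, as `H 0 = 0`.
  obtain ⟨t, ht1, ht2, hgap⟩ := exists_gap_of_card_ne_zero_le hA.eigenvalues
    (m := m) (hA.rank_eq_card_non_zero_eigs ▸ hm) hlam
  set w := lam / (4 * ((m : ℝ) + 1)) with hw
  set b := hA.eigenvectorBasis
  set Φ := Matrix.toEuclideanCLM (n := Fin n) (𝕜 := ℝ) with hΦ
  have hAx : ∀ i x, (inner ℝ (b i) (Φ A x) : ℝ) = hA.eigenvalues i * inner ℝ (b i) x := by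
    intro i x
    have hadj : ContinuousLinearMap.adjoint (Φ A) = Φ A := by
      rw [← ContinuousLinearMap.star_eq_adjoint, ← map_star, Matrix.star_eq_conjTranspose, hA.eq]
    have hb : Φ A (b i) = hA.eigenvalues i • b i := by
      have := hA.mulVec_eigenvectorBasis i
      apply (WithLp.ofLp_injective 2)
      rw [hΦ, Matrix.ofLp_toEuclideanCLM]
      simpa using this
    rw [← ContinuousLinearMap.adjoint_inner_left, hadj, hb, real_inner_smul_left]
  set N := M - t • (1 : Matrix (Fin n) (Fin n) ℝ) with hNdef
  have hN : ∀ c ∈ spectrum ℂ (N.map (fun a : ℝ => (a : ℂ))), c.re ≤ -(t - μ) := by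
    intro c hc
    have hmem : c + t ∈ spectrum ℂ (M.map (fun a : ℝ => (a : ℂ))) := by
      have : M.map (fun a : ℝ => (a : ℂ)) =
          N.map (fun a : ℝ => (a : ℂ)) + algebraMap ℂ (Matrix (Fin n) (Fin n) ℂ) t := by
        ext i j
        by_cases hij : i = j <;> simp [N, Matrix.algebraMap_eq_diagonal, hij]
      rw [this, ← spectrum.add_singleton_eq]
      exact Set.add_mem_add hc rfl
    have := hμ _ hmem
    simp at this
    linarith
  have hε₀ : 0 < 2 * (w - ρ) / (‖N‖ ^ 2 + 1) :=
    div_pos (by linarith) (by positivity)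
  obtain ⟨ε, hε, hεle, hlim⟩ := exists_tendsto_one_add_smul_pow N (η := t - μ) (by linarith) hε₀ hN
  have hεN : ε * ‖N‖ ^ 2 ≤ 2 * (w - ρ) := by
    rw [le_div_iff₀ (by positivity)] at hεle
    nlinarith
  obtain ⟨i₀, hi₀⟩ : ∃ i, t < hA.eigenvalues i := by
    by_contra! hle
    have hsum : (inner ℝ z (Φ A z) : ℝ) = ∑ i, hA.eigenvalues i * (inner ℝ (b i) z : ℝ) ^ 2 := by
      rw [← b.sum_inner_mul_inner]
      refine Finset.sum_congr rfl fun i _ => ?_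
      rw [hAx, real_inner_comm]; ring
    have : ∑ i, hA.eigenvalues i * (inner ℝ (b i) z : ℝ) ^ 2 ≤ t := by
      calc ∑ i, hA.eigenvalues i * (inner ℝ (b i) z : ℝ) ^ 2
          ≤ ∑ i, t * (inner ℝ (b i) z : ℝ) ^ 2 :=
            Finset.sum_le_sum fun i _ => by gcongr; exact hle i
        _ = t := by rw [← Finset.mul_sum, b.sum_sq_inner_right, hz]; simp
    linarith
  set H : EuclideanSpace ℝ (Fin n) → ℝ := fun x =>
    ∑ i, SignType.sign (hA.eigenvalues i - t) * (inner ℝ (b i) x : ℝ) ^ 2 with hH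
  have hstep : ∀ x, H x ≤ H (Φ (1 + ε • N) x) := by
    intro x
    have := sum_sign_mul_sq_le_of_step b (fun i => hA.eigenvalues i - t) (Φ (M - A)) (Φ N)
      (fun i x => by
        have : Φ N x = Φ A x + Φ (M - A) x - t • x := by simp [N]
        rw [this, inner_sub_right, inner_add_right, hAx, real_inner_smul_right]; ring)
      (w := w) (ρ := ρ) (ε := ε) hρ hgap hε.le hεN x
    simpa [H] using this
  have hpow : ∀ k : ℕ, 1 ≤ H (Φ ((1 + ε • N) ^ k) (b i₀)) := by
    intro k
    induction k with
    | zero =>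
      have hs : SignType.sign (hA.eigenvalues i₀ - t) = 1 := sign_pos (by linarith)
      simp only [H, pow_zero, map_one, one_apply_eq_self,
        orthonormal_iff_ite.1 b.orthonormal]
      simp [hs]
    | succ k ih =>
      rw [pow_succ', map_mul]
      exact ih.trans (hstep _)
  have hΦc : Continuous fun T : Matrix (Fin n) (Fin n) ℝ => H (Φ T (b i₀)) := by
    have : Continuous fun T : Matrix (Fin n) (Fin n) ℝ => Φ T (b i₀) :=
      LinearMap.continuous_of_finiteDimensional
        ({ toFun := fun T => Φ T (b i₀)
           map_add' := fun S T => by simp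
           map_smul' := fun c T => by simp } :
          Matrix (Fin n) (Fin n) ℝ →ₗ[ℝ] EuclideanSpace ℝ (Fin n))
    simp only [H]
    fun_prop
  have hlim' := (hΦc.tendsto 0).comp hlim
  have hle := ge_of_tendsto' hlim' hpow
  simp [H] at hle
  linarith

end TopEigenvalue

/-! ### Gaussian mass of shells and perturbation of slabs -/

section SlabPerturbation

/-- Bounds Gaussian integrals with weight `1 + |g|` by Lebesgue measure. -/
theorem one_add_abs_mul_gaussianPDFReal_le (g : ℝ) : (1 + |g|) * gaussianPDFReal 0 1 g ≤ 1 := by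
  simp only [gaussianPDFReal_def]
  have hpi : (2 : ℝ) ≤ √(2 * Real.pi * (1 : NNReal)) := by
    apply Real.le_sqrt_of_sq_le
    have := Real.pi_gt_three
    norm_num
    linarith
  have hexp : 1 + |g| ≤ 2 * Real.exp (g ^ 2 / 2) := by
    have := Real.add_one_le_exp (g ^ 2 / 2)
    nlinarith [sq_abs g, sq_nonneg (|g| - 1)]
  have he : Real.exp (-(g - 0) ^ 2 / (2 * (1 : NNReal))) = (Real.exp (g ^ 2 / 2))⁻¹ := by
    rw [← Real.exp_neg]; congr 1; simp; ring
  rw [he]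
  calc (1 + |g|) * ((√(2 * Real.pi * (1 : NNReal)))⁻¹ * (Real.exp (g ^ 2 / 2))⁻¹)
      ≤ (2 * Real.exp (g ^ 2 / 2)) * (2⁻¹ * (Real.exp (g ^ 2 / 2))⁻¹) := by gcongr
    _ = 1 := by field_simp

/-- The shell lies in two intervals, each of length `2c/κ ≤ 4c`. -/
theorem lintegral_shell_gaussianReal_le {κ c : ℝ} (hκ : 1 / 2 ≤ κ) (hc : 0 ≤ c) :
    ∫⁻ g, {g : ℝ | |κ * |g| - 1| ≤ c}.indicator (fun g => ENNReal.ofReal (1 + |g|)) g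
      ∂(gaussianReal 0 1) ≤ ENNReal.ofReal (8 * c) := by
  have hκ0 : 0 < κ := by linarith
  have hmeas : MeasurableSet {g : ℝ | |κ * |g| - 1| ≤ c} :=
    measurableSet_le (by fun_prop) (by fun_prop)
  rw [gaussianReal_of_var_ne_zero 0 one_ne_zero,
    lintegral_withDensity_eq_lintegral_mul _ (measurable_gaussianPDF 0 1)
      (Measurable.indicator (by fun_prop) hmeas)]
  calc ∫⁻ g, (gaussianPDF 0 1 * {g : ℝ | |κ * |g| - 1| ≤ c}.indicator
          fun g => ENNReal.ofReal (1 + |g|)) g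
      ≤ ∫⁻ g, {g : ℝ | |κ * |g| - 1| ≤ c}.indicator 1 g := by
        refine lintegral_mono fun g => ?_
        by_cases hg : g ∈ {g : ℝ | |κ * |g| - 1| ≤ c}
        · simp only [Pi.mul_apply, Set.indicator_of_mem hg, gaussianPDF_def, Pi.one_apply]
          rw [← ENNReal.ofReal_mul (gaussianPDFReal_nonneg _ _ _), ← ENNReal.ofReal_one, mul_comm]
          exact ENNReal.ofReal_le_ofReal (one_add_abs_mul_gaussianPDFReal_le g)
        · simp [Set.indicator_of_notMem hg]
    _ = volume {g : ℝ | |κ * |g| - 1| ≤ c} := lintegral_indicator_one hmeas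
    _ ≤ volume (Set.Icc ((1 - c) / κ) ((1 + c) / κ) ∪
          Set.Icc (-((1 + c) / κ)) (-((1 - c) / κ))) := by
        refine measure_mono fun g hg => ?_
        have hg' := abs_le.1 (show |κ * |g| - 1| ≤ c from hg)
        have h1 : (1 - c) / κ ≤ |g| := by rw [div_le_iff₀ hκ0]; linarith
        have h2 : |g| ≤ (1 + c) / κ := by rw [le_div_iff₀ hκ0]; linarith
        rcases abs_cases g with ⟨h, -⟩ | ⟨h, -⟩
        · left; rw [h] at h1 h2; exact ⟨h1, h2⟩
        · right; rw [h] at h1 h2; exact ⟨by linarith, by linarith⟩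
    _ ≤ ENNReal.ofReal (4 * c) + ENNReal.ofReal (4 * c) := by
        have hlen : (1 + c) / κ - (1 - c) / κ ≤ 4 * c := by
          rw [← sub_div, div_le_iff₀ hκ0]; nlinarith
        refine (measure_union_le _ _).trans (add_le_add ?_ ?_) <;>
        · rw [Real.volume_Icc]
          exact ENNReal.ofReal_le_ofReal (by linarith)
    _ = ENNReal.ofReal (8 * c) := by
        rw [← ENNReal.ofReal_add (by positivity) (by positivity)]; ring_nf

/-- The constant in the slab perturbation bound. -/
noncomputable def slabConst : ℝ := 8 * (3 + ∫ t : ℝ, t ^ 4 ∂(gaussianReal 0 1))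

theorem slabConst_pos : 0 < slabConst := by
  have : 0 ≤ ∫ t : ℝ, t ^ 4 ∂(gaussianReal 0 1) := integral_nonneg fun t => by positivity
  unfold slabConst
  positivity

variable {E : Type*} [NormedAddCommGroup E] [InnerProductSpace ℝ E] [FiniteDimensional ℝ E]
  [MeasurableSpace E] [BorelSpace E]

/-- Resampling along `p ⊥ b` fixes `⟨b, x⟩`, so the shell becomes one-dimensional of half-width
`β|⟨b, x⟩|`. The integrand is at most `W x * (1 + |t|)`, and what remains is a moment in the
directions `b` and `q'`, the part of `q` orthogonal to `p`. -/
theorem lintegral_shell_stdGaussian_le {b p q : E} (hb : ‖b‖ = 1) (hp : ‖p‖ = 1) (hq : ‖q‖ ≤ 1)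
    (hbp : (inner ℝ b p : ℝ) = 0) {κ β : ℝ} (hκ : 1 / 2 ≤ κ) (hβ : 0 ≤ β) :
    ∫⁻ x, {x : E | |κ * |(inner ℝ p x : ℝ)| - 1| ≤ β * |(inner ℝ b x : ℝ)|}.indicator
      (fun x => ENNReal.ofReal |(inner ℝ b x : ℝ) * inner ℝ q x - inner ℝ b q|) x
      ∂(stdGaussian E) ≤ ENNReal.ofReal (slabConst * β) := by
  have hmeas : MeasurableSet {x : E | |κ * |(inner ℝ p x : ℝ)| - 1| ≤ β * |(inner ℝ b x : ℝ)|} :=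
    measurableSet_le (by fun_prop) (by fun_prop)
  have hpp : (inner ℝ p p : ℝ) = 1 := by rw [real_inner_self_eq_norm_sq, hp]; norm_num
  set q' := q - (inner ℝ q p : ℝ) • p with hq'
  have hq'norm : ‖q'‖ ≤ 1 := by
    have h : ‖q'‖ ^ 2 = ‖q‖ ^ 2 - (inner ℝ q p : ℝ) ^ 2 := by
      rw [hq', norm_sub_sq_real, real_inner_smul_right, norm_smul, hp]
      simp
      ring
    nlinarith [norm_nonneg q', norm_nonneg q, sq_nonneg (inner ℝ q p : ℝ)]
  have hbq : |(inner ℝ b q : ℝ)| ≤ 1 := by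
    have := abs_real_inner_le_norm b q
    rw [hb] at this; linarith
  have hqp : |(inner ℝ q p : ℝ)| ≤ 1 := by
    have := abs_real_inner_le_norm q p
    rw [hp] at this; linarith
  rw [lintegral_stdGaussian_resample hp (Measurable.indicator (by fun_prop) hmeas)]
  set W : E → ℝ := fun x => (1 + |(inner ℝ b x : ℝ)|) * (1 + |(inner ℝ q' x : ℝ)|) with hW
  have hW0 : ∀ x, 0 ≤ W x := fun x => by positivity
  have inner_bound : ∀ x : E,
      ∫⁻ t, {x : E | |κ * |(inner ℝ p x : ℝ)| - 1| ≤ β * |(inner ℝ b x : ℝ)|}.indicator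
        (fun x => ENNReal.ofReal |(inner ℝ b x : ℝ) * inner ℝ q x - inner ℝ b q|)
        (x - (inner ℝ p x : ℝ) • p + t • p) ∂(gaussianReal 0 1) ≤
      ENNReal.ofReal (8 * β *
        (1 + (inner ℝ b x : ℝ) ^ 2 + (inner ℝ b x : ℝ) ^ 4 + (inner ℝ q' x : ℝ) ^ 2)) := by
    intro x
    have e1 : ∀ t : ℝ, (inner ℝ p (x - (inner ℝ p x : ℝ) • p + t • p) : ℝ) = t := fun t => by
      rw [inner_add_right, inner_sub_right, real_inner_smul_right, real_inner_smul_right, hpp]; ring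
    have e2 : ∀ t : ℝ, (inner ℝ b (x - (inner ℝ p x : ℝ) • p + t • p) : ℝ) = inner ℝ b x :=
      fun t => by
        rw [inner_add_right, inner_sub_right, real_inner_smul_right, real_inner_smul_right, hbp]
        ring
    have e3 : ∀ t : ℝ, (inner ℝ q (x - (inner ℝ p x : ℝ) • p + t • p) : ℝ) =
        inner ℝ q' x + t * inner ℝ q p := fun t => by
      rw [inner_add_right, inner_sub_right, real_inner_smul_right, real_inner_smul_right, hq',
        inner_sub_left, real_inner_smul_left]
      ring
    calc _ ≤ ∫⁻ t, ENNReal.ofReal (W x) *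
          {g : ℝ | |κ * |g| - 1| ≤ β * |(inner ℝ b x : ℝ)|}.indicator
            (fun g => ENNReal.ofReal (1 + |g|)) t ∂(gaussianReal 0 1) := by
          refine lintegral_mono fun t => ?_
          simp only [Set.indicator_apply, Set.mem_ofPred_eq, e1, e2, e3]
          split_ifs
          · rw [← ENNReal.ofReal_mul (hW0 x)]
            refine ENNReal.ofReal_le_ofReal ?_
            calc |(inner ℝ b x : ℝ) * (inner ℝ q' x + t * inner ℝ q p) - inner ℝ b q|
                ≤ |(inner ℝ b x : ℝ) * (inner ℝ q' x + t * inner ℝ q p)| + |(inner ℝ b q : ℝ)| :=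
                  abs_sub _ _
              _ ≤ |(inner ℝ b x : ℝ)| * (|(inner ℝ q' x : ℝ)| + |t| * 1) + 1 := by
                  rw [abs_mul]
                  gcongr
                  refine (abs_add_le _ _).trans ?_
                  rw [abs_mul]
                  gcongr
              _ ≤ W x * (1 + |t|) := by
                  simp only [hW]
                  nlinarith [abs_nonneg t, abs_nonneg (inner ℝ b x : ℝ),
                    abs_nonneg (inner ℝ q' x : ℝ),
                    mul_nonneg (abs_nonneg t) (abs_nonneg (inner ℝ q' x : ℝ)),
                    mul_nonneg (mul_nonneg (abs_nonneg t) (abs_nonneg (inner ℝ q' x : ℝ)))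
                      (abs_nonneg (inner ℝ b x : ℝ))]
          · simp
      _ ≤ ENNReal.ofReal (W x) * ENNReal.ofReal (8 * (β * |(inner ℝ b x : ℝ)|)) := by
          rw [lintegral_const_mul' _ _ ENNReal.ofReal_ne_top]
          gcongr
          exact lintegral_shell_gaussianReal_le hκ (by positivity)
      _ ≤ _ := by
          rw [← ENNReal.ofReal_mul (hW0 x)]
          refine ENNReal.ofReal_le_ofReal ?_
          have hkey : W x * |(inner ℝ b x : ℝ)| ≤
              1 + (inner ℝ b x : ℝ) ^ 2 + (inner ℝ b x : ℝ) ^ 4 + (inner ℝ q' x : ℝ) ^ 2 := by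
            simp only [hW]
            generalize hs : (inner ℝ b x : ℝ) = s
            generalize hy : (inner ℝ q' x : ℝ) = y
            rw [← sq_abs s, ← sq_abs y, show s ^ 4 = |s| ^ 4 by
              rw [show (4 : ℕ) = 2 * 2 from rfl, pow_mul, pow_mul, sq_abs]]
            nlinarith [sq_nonneg (|s| + |s| ^ 2 - (1 + |y|)), sq_nonneg (|s| - |s| ^ 2),
              sq_nonneg (|y| - 1)]
          nlinarith [mul_le_mul_of_nonneg_left hkey (by positivity : 0 ≤ 8 * β)]
  refine (lintegral_mono inner_bound).trans ?_
  have i2 := integral_inner_pow_stdGaussian hb 2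
  have i4 := integral_inner_pow_stdGaussian hb 4
  have iq := (memLp_inner_stdGaussian q' 2 (by simp)).integrable_sq
  have iall : Integrable (fun x : E => 8 * β *
        (1 + (inner ℝ b x : ℝ) ^ 2 + (inner ℝ b x : ℝ) ^ 4 + (inner ℝ q' x : ℝ) ^ 2))
        (stdGaussian E) :=
    ((((integrable_const 1).add i2.1).add i4.1).add iq).const_mul _
  rw [← ofReal_integral_eq_lintegral_ofReal iall
    (Filter.Eventually.of_forall fun x => by positivity)]
  refine ENNReal.ofReal_le_ofReal ?_
  rw [integral_const_mul, integral_add (by exact ((integrable_const 1).add i2.1).add i4.1) iq,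
    integral_add (by exact (integrable_const 1).add i2.1) i4.1,
    integral_add (integrable_const 1) i2.1, i2.2, i4.2, integral_sq_gaussianReal,
    integral_inner_sq_stdGaussian]
  simp only [integral_const, probReal_univ, smul_eq_mul, mul_one]
  unfold slabConst
  have : ‖q'‖ ^ 2 ≤ 1 := by nlinarith [norm_nonneg q']
  nlinarith

theorem integrable_inner_mul_inner_sub_stdGaussian (y q : E) :
    Integrable (fun x => (inner ℝ y x : ℝ) * inner ℝ q x - inner ℝ y q) (stdGaussian E) :=
  (integrable_inner_mul_inner_stdGaussian y q).sub (integrable_const _)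

/-- Conditionally on the other coordinates the event is fixed, and the integrand has mean zero in
the `b`-coordinate since `E t = 0` and `E t² = 1`. -/
theorem integral_indicator_of_invariant {b q : E} (hb : ‖b‖ = 1) {A : Set E}
    (hA : MeasurableSet A) (hinv : ∀ x (t : ℝ), x + t • b ∈ A ↔ x ∈ A) :
    ∫ x, A.indicator (fun x => (inner ℝ b x : ℝ) * inner ℝ q x - inner ℝ b q) x
      ∂(stdGaussian E) = 0 := by
  rw [integral_stdGaussian_resample hb
    ((integrable_inner_mul_inner_sub_stdGaussian b q).indicator hA)]
  refine integral_eq_zero_of_ae (Filter.Eventually.of_forall fun x => ?_)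
  have hbb : (inner ℝ b b : ℝ) = 1 := by rw [real_inner_self_eq_norm_sq, hb]; norm_num
  have e1 : ∀ t : ℝ, (inner ℝ b (x - (inner ℝ b x : ℝ) • b + t • b) : ℝ) = t := fun t => by
    rw [inner_add_right, inner_sub_right, real_inner_smul_right, real_inner_smul_right, hbb]; ring
  have e2 : ∀ t : ℝ, (inner ℝ q (x - (inner ℝ b x : ℝ) • b + t • b) : ℝ) =
      inner ℝ q (x - (inner ℝ b x : ℝ) • b) + t * inner ℝ q b := fun t => by
    rw [inner_add_right, real_inner_smul_right]
  classical
  simp only [Set.indicator_apply, hinv, e1, e2, Pi.zero_apply]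
  split_ifs with h
  · have i1 := integrable_pow_gaussianReal 1
    have i2 := integrable_pow_gaussianReal 2
    simp only [pow_one] at i1
    have : ∀ t : ℝ, t * (inner ℝ q (x - (inner ℝ b x : ℝ) • b) + t * inner ℝ q b) - inner ℝ b q =
        inner ℝ q (x - (inner ℝ b x : ℝ) • b) * t + inner ℝ q b * t ^ 2 - inner ℝ q b := fun t => by
      rw [real_inner_comm b q]; ring
    simp_rw [this]
    rw [integral_sub (by exact (i1.const_mul _).add (i2.const_mul _)) (integrable_const _),
      integral_add (i1.const_mul _) (i2.const_mul _), integral_const_mul, integral_const_mul,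
      integral_sq_gaussianReal, integral_id_gaussianReal]
    simp
  · simp

/-- The second moment in a direction `b` along which the event `S` is invariant and which is nearly
orthogonal to the normals `v i` of the slabs is small. -/
theorem abs_integral_slab_indicator_le {ℓ : ℕ} {b q : E} (hb : ‖b‖ = 1) (hq : ‖q‖ ≤ 1) {S : Set E}
    (hS : MeasurableSet S) (hinv : ∀ x (t : ℝ), x + t • b ∈ S ↔ x ∈ S) {v : Fin ℓ → E}
    (hv : ∀ i, ‖v i‖ = 1) (hvb : ∀ i, |(inner ℝ (v i) b : ℝ)| ≤ 1 / 2) :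
    |∫ x, (S ∩ {x | ∀ i, |(inner ℝ (v i) x : ℝ)| ≤ 1}).indicator
      (fun x => (inner ℝ b x : ℝ) * inner ℝ q x - inner ℝ b q) x ∂(stdGaussian E)| ≤
      slabConst * ∑ i, |(inner ℝ (v i) b : ℝ)| := by
  set f : E → ℝ := fun x => (inner ℝ b x : ℝ) * inner ℝ q x - inner ℝ b q with hf
  have hbb : (inner ℝ b b : ℝ) = 1 := by rw [real_inner_self_eq_norm_sq, hb]; norm_num
  have hfi : Integrable f (stdGaussian E) := integrable_inner_mul_inner_sub_stdGaussian b q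
  set A := S ∩ {x | ∀ i, |(inner ℝ (v i) x : ℝ)| ≤ 1} with hA
  -- Tilted slabs, with the `b`-component removed from each normal: invariant along `b`, hence
  -- contributing zero.
  set A' := S ∩ {x | ∀ i, |(inner ℝ (v i) x : ℝ) - inner ℝ (v i) b * inner ℝ b x| ≤ 1} with hA'
  have hAm : MeasurableSet A := by
    refine hS.inter ?_
    rw [Set.ofPred_forall]
    exact MeasurableSet.iInter fun i => measurableSet_le (by fun_prop) (by fun_prop)
  have hA'm : MeasurableSet A' := by
    refine hS.inter ?_
    rw [Set.ofPred_forall]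
    exact MeasurableSet.iInter fun i => measurableSet_le (by fun_prop) (by fun_prop)
  have hzero : ∫ x, A'.indicator f x ∂(stdGaussian E) = 0 := by
    refine integral_indicator_of_invariant hb hA'm fun x t => ?_
    simp only [hA', Set.mem_inter_iff, hinv, Set.mem_ofPred_eq, inner_add_right,
      real_inner_smul_right, hbb]
    refine and_congr_right fun _ => forall_congr' fun i => ?_
    rw [show (inner ℝ (v i) x : ℝ) + t * inner ℝ (v i) b -
      inner ℝ (v i) b * (inner ℝ b x + t * 1) =
      inner ℝ (v i) x - inner ℝ (v i) b * inner ℝ b x by ring]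
  -- A point in exactly one of `A`, `A'` lies in the shell of some `i`, where the tilted form is
  -- within the size of the tilt of the threshold `1`.
  set D : Fin ℓ → Set E := fun i =>
    {x | |(|(inner ℝ (v i) x : ℝ) - inner ℝ (v i) b * inner ℝ b x|) - 1| ≤
      |(inner ℝ (v i) b : ℝ)| * |(inner ℝ b x : ℝ)|} with hD
  have hpt : ∀ x, ‖A.indicator f x - A'.indicator f x‖ₑ ≤
      ∑ i, (D i).indicator (fun x => ENNReal.ofReal |f x|) x := by
    intro x
    by_cases hx : x ∈ A ↔ x ∈ A'
    · by_cases h : x ∈ A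
      · simp [Set.indicator_of_mem h, Set.indicator_of_mem (hx.1 h)]
      · simp [Set.indicator_of_notMem h, Set.indicator_of_notMem (mt hx.2 h)]
    · obtain ⟨i, hi⟩ : ∃ i, x ∈ D i := by
        by_contra! hnot
        refine hx (and_congr_right fun _ => forall_congr' fun i => ?_)
        have h := hnot i
        simp only [hD, Set.mem_ofPred_eq, not_le] at h
        set y := (inner ℝ (v i) x : ℝ)
        rw [← abs_mul] at h
        set c := (inner ℝ (v i) b : ℝ) * inner ℝ b x
        have h1 : |y| ≤ |y - c| + |c| := by simpa using abs_add_le (y - c) c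
        have h2 : |y - c| ≤ |y| + |c| := abs_sub _ _
        rcases lt_abs.1 h with h | h
        · constructor <;> intro h' <;> linarith
        · constructor <;> intro h' <;> linarith [abs_nonneg c]
      have hle : ‖A.indicator f x - A'.indicator f x‖ₑ ≤ ENNReal.ofReal |f x| := by
        rw [← Real.enorm_eq_ofReal_abs]
        by_cases h : x ∈ A <;> by_cases h' : x ∈ A' <;> simp [h, h']
      refine hle.trans ?_
      refine le_trans ?_ (Finset.single_le_sum (fun _ _ => zero_le) (Finset.mem_univ i))
      rw [Set.indicator_of_mem hi]
  have hDi : ∀ i, ∫⁻ x, (D i).indicator (fun x => ENNReal.ofReal |f x|) x ∂(stdGaussian E) ≤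
      ENNReal.ofReal (slabConst * |(inner ℝ (v i) b : ℝ)|) := by
    intro i
    set β := (inner ℝ (v i) b : ℝ) with hβ
    have hβsq : β ^ 2 ≤ 1 / 4 := by
      rw [← sq_abs]; nlinarith [hvb i, abs_nonneg β]
    -- The norm of the tilted normal, which is rescaled to a unit vector for the shell estimate.
    set κ := √(1 - β ^ 2) with hκ
    have hκhalf : 1 / 2 ≤ κ := Real.le_sqrt_of_sq_le (by linarith)
    have hκ0 : κ ≠ 0 := by linarith
    have hκsq : κ ^ 2 = 1 - β ^ 2 := Real.sq_sqrt (by linarith)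
    have hnorm : ‖v i - β • b‖ ^ 2 = κ ^ 2 := by
      rw [norm_sub_sq_real, real_inner_smul_right, norm_smul, hb, hv i, ← hβ, hκsq]
      simp
      ring
    have hnorm' : ‖v i - β • b‖ = κ :=
      (sq_eq_sq₀ (norm_nonneg _) (by linarith)).1 hnorm
    have := lintegral_shell_stdGaussian_le (b := b) (p := κ⁻¹ • (v i - β • b)) (q := q) hb
      (by rw [norm_smul, hnorm', Real.norm_of_nonneg (by positivity), inv_mul_cancel₀ hκ0]) hq
      (by rw [real_inner_smul_right, inner_sub_right, real_inner_smul_right, hbb,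
        real_inner_comm, ← hβ]; ring) hκhalf (abs_nonneg β)
    convert this using 5 with x
    funext x
    rw [real_inner_smul_left, inner_sub_left, real_inner_smul_left, abs_mul,
      abs_of_nonneg (by positivity : 0 ≤ κ⁻¹), mul_inv_cancel_left₀ hκ0]
  have hsub : ∫ x, A.indicator f x ∂(stdGaussian E) =
      ∫ x, (A.indicator f x - A'.indicator f x) ∂(stdGaussian E) := by
    rw [integral_sub (hfi.indicator hAm) (hfi.indicator hA'm), hzero, sub_zero]
  have hDm : ∀ i, MeasurableSet (D i) := fun i =>
    measurableSet_le (by fun_prop) (by fun_prop)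
  rw [hsub, ← ENNReal.ofReal_le_ofReal_iff
    (mul_nonneg slabConst_pos.le (Finset.sum_nonneg fun _ _ => abs_nonneg _)),
    ← Real.enorm_eq_ofReal_abs]
  calc _ ≤ ∫⁻ x, ‖A.indicator f x - A'.indicator f x‖ₑ ∂(stdGaussian E) :=
        enorm_integral_le_lintegral_enorm _
    _ ≤ ∫⁻ x, ∑ i, (D i).indicator (fun x => ENNReal.ofReal |f x|) x ∂(stdGaussian E) :=
        lintegral_mono hpt
    _ = ∑ i, ∫⁻ x, (D i).indicator (fun x => ENNReal.ofReal |f x|) x ∂(stdGaussian E) := by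
        refine lintegral_finsetSum _ fun i _ => Measurable.indicator (by fun_prop) (hDm i)
    _ ≤ ∑ i, ENNReal.ofReal (slabConst * |(inner ℝ (v i) b : ℝ)|) :=
        Finset.sum_le_sum fun i _ => hDi i
    _ = _ := by
        rw [← ENNReal.ofReal_sum_of_nonneg
          fun i _ => mul_nonneg slabConst_pos.le (abs_nonneg _), Finset.mul_sum]

end SlabPerturbation

/-! ### Orthogonal projections -/

section Geometry

variable {E : Type*} [NormedAddCommGroup E] [InnerProductSpace ℝ E] [FiniteDimensional ℝ E]

theorem starProjection_span_range_eq_sum {k : ℕ} {v : Fin k → E} (hv : Orthonormal ℝ v) (x : E) :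
    (Submodule.span ℝ (Set.range v)).starProjection x = ∑ i, (inner ℝ (v i) x : ℝ) • v i := by
  have hmem : ∑ i, (inner ℝ (v i) x : ℝ) • v i ∈ Submodule.span ℝ (Set.range v) :=
    Submodule.sum_mem _ fun i _ => Submodule.smul_mem _ _ (Submodule.subset_span ⟨i, rfl⟩)
  refine Submodule.eq_starProjection_of_mem_of_inner_eq_zero hmem ?_
  intro w hw
  induction hw using Submodule.span_induction with
  | mem w hw =>
    obtain ⟨j, rfl⟩ := hw
    rw [inner_sub_left, sum_inner]
    simp only [real_inner_smul_left, orthonormal_iff_ite.1 hv]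
    simp [real_inner_comm]
  | zero => simp
  | add a b _ _ ha hb => rw [inner_add_right, ha, hb, add_zero]
  | smul c a _ ha => rw [real_inner_smul_right, ha, mul_zero]

theorem norm_sq_starProjection_span_range {k : ℕ} {v : Fin k → E} (hv : Orthonormal ℝ v) (x : E) :
    ‖(Submodule.span ℝ (Set.range v)).starProjection x‖ ^ 2 =
      ∑ i, (inner ℝ (v i) x : ℝ) ^ 2 := by
  rw [starProjection_span_range_eq_sum hv, ← real_inner_self_eq_norm_sq, hv.inner_sum]
  simp [sq]

theorem norm_sub_starProjection_sq (U : Submodule ℝ E) (x : E) :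
    ‖x - U.starProjection x‖ ^ 2 = ‖x‖ ^ 2 - ‖U.starProjection x‖ ^ 2 := by
  have h := U.norm_sq_eq_add_norm_sq_starProjection x
  rw [U.starProjection_orthogonal'] at h
  have h2 : (1 - U.starProjection) x = x - U.starProjection x := by simp
  change ‖x‖ ^ 2 = _ + ‖(1 - U.starProjection) x‖ ^ 2 at h
  rw [h2] at h
  linarith

theorem inner_orthogonal_eq {U : Submodule ℝ E} {b : E} (hb : b ∈ Uᗮ) (x : E) :
    (inner ℝ x b : ℝ) = inner ℝ (x - U.starProjection x) b := by
  rw [inner_sub_left, (Submodule.mem_orthogonal _ _).1 hb _ (U.starProjection_apply_mem x), sub_zero]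

/-- Projecting onto `U` loses at most what is lost by projecting onto `V` and onto the part of
`U ⊔ V` orthogonal to `V`. -/
theorem norm_starProjection_sq_le (U V : Submodule ℝ E) (x : E) :
    ‖U.starProjection x‖ ^ 2 ≤ ‖V.starProjection x‖ ^ 2 +
      ‖(Vᗮ ⊓ (U ⊔ V)).starProjection x‖ ^ 2 := by
  set Z := Vᗮ ⊓ (U ⊔ V)
  set y := U.starProjection x with hy
  have hyU : y ∈ U := U.starProjection_apply_mem x
  have hyV : V.starProjection y ∈ V := V.starProjection_apply_mem y
  -- So `‖y‖² = ⟨y, x⟩` only sees the projections of `x` to `V` and `Z`, and Cauchy–Schwarz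
  -- finishes.
  have hz : y - V.starProjection y ∈ Z := by
    refine ⟨V.sub_starProjection_mem_orthogonal y, ?_⟩
    exact Submodule.sub_mem _ (Submodule.mem_sup_left hyU) (Submodule.mem_sup_right hyV)
  have proj_inner : ∀ (W : Submodule ℝ E) (a : E), a ∈ W →
      (inner ℝ a x : ℝ) = inner ℝ a (W.starProjection x) := by
    intro W a ha
    rw [← W.inner_starProjection_left_eq_right, W.starProjection_eq_self_iff.2 ha]
  have h1 : ‖y‖ ^ 2 = inner ℝ y x := by
    rw [proj_inner U y hyU, ← hy, real_inner_self_eq_norm_sq]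
  have h2 : (inner ℝ y x : ℝ) = inner ℝ (V.starProjection y) (V.starProjection x) +
      inner ℝ (y - V.starProjection y) (Z.starProjection x) := by
    rw [← proj_inner V _ hyV, ← proj_inner Z _ hz, ← inner_add_left, add_sub_cancel]
  have h3 := real_inner_le_norm (V.starProjection y) (V.starProjection x)
  have h4 := real_inner_le_norm (y - V.starProjection y) (Z.starProjection x)
  have h5 := norm_sub_starProjection_sq V y
  rw [← h1] at h2
  set a := ‖V.starProjection y‖
  set b := ‖y - V.starProjection y‖
  set c := ‖V.starProjection x‖
  set e := ‖Z.starProjection x‖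
  have h6 : ‖y‖ ^ 2 ≤ a * c + b * e := by linarith
  have h7 : ‖y‖ ^ 2 * ‖y‖ ^ 2 ≤ ‖y‖ ^ 2 * (c ^ 2 + e ^ 2) := by
    have h8 : ‖y‖ ^ 2 = a ^ 2 + b ^ 2 := by linarith
    calc ‖y‖ ^ 2 * ‖y‖ ^ 2 ≤ (a * c + b * e) * (a * c + b * e) := by gcongr
      _ ≤ (a ^ 2 + b ^ 2) * (c ^ 2 + e ^ 2) := by nlinarith [sq_nonneg (a * e - b * c)]
      _ = _ := by rw [h8]
  rcases (sq_nonneg ‖y‖).eq_or_lt with h | h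
  · rw [← h]; positivity
  · exact le_of_mul_le_mul_left h7 h

end Geometry

/-! ### The trimmed moment as a bilinear form -/

section TrimmedMoment

variable {n ℓ : ℕ} (P : MvPolynomial (Fin n) ℝ) (τ : ℝ) (v : Fin ℓ → EuclideanSpace ℝ (Fin n))

theorem measurableSet_setOf_lt_abs_eval :
    MeasurableSet {x : EuclideanSpace ℝ (Fin n) | τ < |MvPolynomial.eval (fun k => x k) P|} :=
  (isOpen_lt continuous_const (continuous_eval_euclidean P).abs).measurableSet

theorem trimEvent_eq_inter : trimEvent P τ v =
    {x | τ < |MvPolynomial.eval (fun k => x k) P|} ∩ {x | ∀ i, |(inner ℝ (v i) x : ℝ)| ≤ 1} :=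
  rfl

theorem measurableSet_trimEvent : MeasurableSet (trimEvent P τ v) := by
  rw [trimEvent_eq_inter]
  refine (measurableSet_setOf_lt_abs_eval P τ).inter ?_
  rw [Set.ofPred_forall]
  exact MeasurableSet.iInter fun i => measurableSet_le (by fun_prop) (by fun_prop)

theorem inner_trimmedMoment (y q : EuclideanSpace ℝ (Fin n)) :
    (inner ℝ y (Matrix.toEuclideanCLM (n := Fin n) (𝕜 := ℝ) (trimmedMoment P τ v) q) : ℝ) =
      ∫ x, (trimEvent P τ v).indicator
        (fun x => (inner ℝ y x : ℝ) * inner ℝ q x - inner ℝ y q) x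
        ∂(stdGaussian (EuclideanSpace ℝ (Fin n))) := by
  have hcoord : ∀ (i : Fin n) (x : EuclideanSpace ℝ (Fin n)),
      x i = inner ℝ (EuclideanSpace.single i (1 : ℝ)) x := fun i x => by
    rw [EuclideanSpace.inner_single_left]; simp
  have hint : ∀ i j, Integrable (fun x : EuclideanSpace ℝ (Fin n) =>
      (trimEvent P τ v).indicator
        (fun x => x i * x j - (1 : Matrix (Fin n) (Fin n) ℝ) i j) x)
      (stdGaussian (EuclideanSpace ℝ (Fin n))) := by
    intro i j
    refine Integrable.indicator ?_ (measurableSet_trimEvent P τ v)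
    simp_rw [hcoord]
    exact (integrable_inner_mul_inner_stdGaussian _ _).sub (integrable_const _)
  have hpt : ∀ x, (trimEvent P τ v).indicator
      (fun x => (inner ℝ y x : ℝ) * inner ℝ q x - inner ℝ y q) x =
      ∑ i, ∑ j, y i * q j * (trimEvent P τ v).indicator
        (fun x => x i * x j - (1 : Matrix (Fin n) (Fin n) ℝ) i j) x := by
    intro x
    by_cases hx : x ∈ trimEvent P τ v
    · simp only [Set.indicator_of_mem hx, PiLp.inner_apply, Finset.sum_mul_sum, mul_sub,
        Finset.sum_sub_distrib, RCLike.inner_apply, conj_trivial]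
      congr 1
      · refine Finset.sum_congr rfl fun i _ => Finset.sum_congr rfl fun j _ => ?_
        ring
      · refine Finset.sum_congr rfl fun i _ => ?_
        simp [Matrix.one_apply, mul_comm]
    · simp [Set.indicator_of_notMem hx]
  simp_rw [hpt]
  rw [integral_finsetSum _ fun i _ => integrable_finsetSum _ fun j _ => (hint i j).const_mul _,
    Matrix.inner_toEuclideanCLM]
  simp only [dotProduct, Matrix.mulVec, Finset.mul_sum]
  refine Finset.sum_congr rfl fun i _ => ?_
  rw [integral_finsetSum _ fun j _ => (hint i j).const_mul _]
  refine Finset.sum_congr rfl fun j _ => ?_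
  rw [integral_const_mul]
  simp only [trimmedMoment, Matrix.of_apply]
  ring

theorem trimmedMoment_isHermitian : (trimmedMoment P τ v).IsHermitian := by
  ext i j
  simp [trimmedMoment, mul_comm, Matrix.one_apply, eq_comm]

theorem toEuclideanCLM_projMatrix (W : Submodule ℝ (EuclideanSpace ℝ (Fin n))) :
    Matrix.toEuclideanCLM (n := Fin n) (𝕜 := ℝ) (projMatrix W) = W.starProjection := by
  simp [projMatrix]

theorem projMatrix_isHermitian (W : Submodule ℝ (EuclideanSpace ℝ (Fin n))) :
    (projMatrix W).IsHermitian := by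
  change star (projMatrix W) = projMatrix W
  apply EquivLike.injective (Matrix.toEuclideanCLM (n := Fin n) (𝕜 := ℝ))
  rw [map_star, toEuclideanCLM_projMatrix]
  exact isSelfAdjoint_starProjection W

theorem trimmedMatrix_isHermitian : (trimmedMatrix P τ v).IsHermitian := by
  have hQ := projMatrix_isHermitian (Submodule.span ℝ (Set.range v))ᗮ
  have := Matrix.isHermitian_mul_mul_conjTranspose
    (projMatrix (Submodule.span ℝ (Set.range v))ᗮ) (trimmedMoment_isHermitian P τ v)
  rwa [hQ.eq] at this

theorem inner_trimmedMatrix (y q : EuclideanSpace ℝ (Fin n)) :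
    (inner ℝ y (Matrix.toEuclideanCLM (n := Fin n) (𝕜 := ℝ) (trimmedMatrix P τ v) q) : ℝ) =
      inner ℝ ((Submodule.span ℝ (Set.range v))ᗮ.starProjection y)
        (Matrix.toEuclideanCLM (n := Fin n) (𝕜 := ℝ) (trimmedMoment P τ v)
          ((Submodule.span ℝ (Set.range v))ᗮ.starProjection q)) := by
  rw [trimmedMatrix, map_mul, map_mul, toEuclideanCLM_projMatrix,
    Submodule.inner_starProjection_left_eq_right]
  rfl

/-- A crude bound from `|ab| ≤ (a² + b²)/2` and unit variances; it is applied where one argument is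
already small. -/
theorem abs_inner_trimmedMoment_le (y q : EuclideanSpace ℝ (Fin n)) :
    |(inner ℝ y (Matrix.toEuclideanCLM (n := Fin n) (𝕜 := ℝ) (trimmedMoment P τ v) q) : ℝ)| ≤
      2 * ‖y‖ * ‖q‖ := by
  have unit : ∀ y q : EuclideanSpace ℝ (Fin n), ‖y‖ = 1 → ‖q‖ = 1 →
      |(inner ℝ y (Matrix.toEuclideanCLM (n := Fin n) (𝕜 := ℝ) (trimmedMoment P τ v) q) : ℝ)| ≤
        2 := by
    intro y q hy hq
    rw [inner_trimmedMoment, ← Real.norm_eq_abs]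
    have hle : |(inner ℝ y q : ℝ)| ≤ 1 := by
      simpa [hy, hq] using abs_real_inner_le_norm y q
    have iy := (memLp_inner_stdGaussian y 2 (by simp)).integrable_sq
    have iq := (memLp_inner_stdGaussian q 2 (by simp)).integrable_sq
    calc _ ≤ ∫ x, (2⁻¹ * (inner ℝ y x : ℝ) ^ 2 + 2⁻¹ * (inner ℝ q x : ℝ) ^ 2) + 1
            ∂(stdGaussian (EuclideanSpace ℝ (Fin n))) := by
          refine norm_integral_le_of_norm_le (((iy.const_mul 2⁻¹).add (iq.const_mul 2⁻¹)).add
            (integrable_const (1 : ℝ))) (Filter.Eventually.of_forall fun x => ?_)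
          refine (norm_indicator_le_norm_self _ _).trans ?_
          rw [Real.norm_eq_abs]
          refine (abs_sub _ _).trans (add_le_add ?_ hle)
          rw [abs_mul, ← sq_abs (inner ℝ y x : ℝ), ← sq_abs (inner ℝ q x : ℝ)]
          nlinarith [sq_nonneg (|(inner ℝ y x : ℝ)| - |(inner ℝ q x : ℝ)|)]
      _ = 2 := by
          rw [integral_add (by exact (iy.const_mul _).add (iq.const_mul _)) (integrable_const _),
            integral_add (iy.const_mul _) (iq.const_mul _), integral_const_mul, integral_const_mul,
            integral_inner_sq_stdGaussian, integral_inner_sq_stdGaussian, hy, hq]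
          simp
          norm_num
  rcases eq_or_ne y 0 with rfl | hy
  · simp
  rcases eq_or_ne q 0 with rfl | hq
  · simp
  have hy' := norm_pos_iff.2 hy
  have hq' := norm_pos_iff.2 hq
  have h := unit (‖y‖⁻¹ • y) (‖q‖⁻¹ • q) (norm_smul_inv_norm hy) (norm_smul_inv_norm hq)
  rw [map_smul, real_inner_smul_left, real_inner_smul_right, abs_mul, abs_mul,
    abs_of_pos (inv_pos.2 hy'), abs_of_pos (inv_pos.2 hq'), ← mul_assoc, ← mul_inv,
    inv_mul_le_iff₀ (by positivity)] at h
  linarith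

/-- In a direction along which `P` does not vary, the trimmed moment is controlled by the
correlations with the slab normals. -/
theorem abs_inner_trimmedMoment_le_of_invariant {b : EuclideanSpace ℝ (Fin n)}
    (hinv : ∀ (x : EuclideanSpace ℝ (Fin n)) (t : ℝ),
      MvPolynomial.eval (fun k => (x + t • b) k) P = MvPolynomial.eval (fun k => x k) P)
    (hv : ∀ i, ‖v i‖ = 1) (hvb : ∀ i, |(inner ℝ (v i) b : ℝ)| ≤ ‖b‖ / 2)
    (q : EuclideanSpace ℝ (Fin n)) :
    |(inner ℝ b (Matrix.toEuclideanCLM (n := Fin n) (𝕜 := ℝ) (trimmedMoment P τ v) q) : ℝ)| ≤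
      slabConst * (∑ i, |(inner ℝ (v i) b : ℝ)|) * ‖q‖ := by
  rcases eq_or_ne b 0 with rfl | hb
  · simp
  rcases eq_or_ne q 0 with rfl | hq
  · simp
  have hb' := norm_pos_iff.2 hb
  have hq' := norm_pos_iff.2 hq
  have h := abs_integral_slab_indicator_le (b := ‖b‖⁻¹ • b) (q := ‖q‖⁻¹ • q)
    (norm_smul_inv_norm hb) (norm_smul_inv_norm hq).le (measurableSet_setOf_lt_abs_eval P τ)
    (fun x t => by
      have := hinv x (t * ‖b‖⁻¹)
      rw [mul_smul] at this
      simp only [Set.mem_ofPred_eq, this]) hv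
    (fun i => by
      rw [real_inner_smul_right, abs_mul, abs_of_pos (inv_pos.2 hb'), inv_mul_le_iff₀ hb']
      linarith [hvb i])
  rw [← trimEvent_eq_inter, ← inner_trimmedMoment] at h
  simp only [map_smul, real_inner_smul_left, real_inner_smul_right, abs_mul,
    abs_of_pos (inv_pos.2 hb'), abs_of_pos (inv_pos.2 hq'), ← Finset.mul_sum] at h
  rw [← mul_assoc, ← mul_inv, inv_mul_le_iff₀ (by positivity)] at h
  refine h.trans (le_of_eq ?_)
  field_simp

end TrimmedMoment

/-! ### Spectral properties of the trimmed matrix relative to the hidden subspace -/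

section HiddenSubspace

theorem totalDegree_aeval_le {σ ι : Type*} {g : σ → MvPolynomial ι ℝ}
    (hg : ∀ k, (g k).totalDegree ≤ 1) (p : MvPolynomial σ ℝ) :
    (MvPolynomial.aeval g p).totalDegree ≤ p.totalDegree := by
  rw [MvPolynomial.aeval_def, MvPolynomial.eval₂_eq]
  refine MvPolynomial.totalDegree_finsetSum_le fun m hm => ?_
  refine (MvPolynomial.totalDegree_mul _ _).trans ?_
  rw [MvPolynomial.algebraMap_eq, MvPolynomial.totalDegree_C, zero_add]
  refine (MvPolynomial.totalDegree_finsetProd _ _).trans ?_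
  refine le_trans (Finset.sum_le_sum fun i _ => ?_) (MvPolynomial.le_totalDegree hm)
  exact (MvPolynomial.totalDegree_pow _ _).trans (by nlinarith [hg i])

variable {n r d : ℕ} {α : ℝ} {U : Submodule ℝ (EuclideanSpace ℝ (Fin n))}
  {P : MvPolynomial (Fin n) ℝ}

/-- `h` is recovered from `P` by the linear substitution `x = ∑ y i • u i`. The degree bound places
`h` in the finite-dimensional space where compactness is used. -/
theorem totalDegree_link_le {u : Fin r → EuclideanSpace ℝ (Fin n)} (hu : Orthonormal ℝ u)
    {h : MvPolynomial (Fin r) ℝ}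
    (hP : ∀ x : EuclideanSpace ℝ (Fin n),
      MvPolynomial.eval (fun k => x k) P = MvPolynomial.eval (fun i => inner ℝ (u i) x) h) :
    h.totalDegree ≤ P.totalDegree := by
  have heq : h = MvPolynomial.aeval
      (fun k => ∑ i, MvPolynomial.C (u i k) * MvPolynomial.X (R := ℝ) i) P := by
    refine MvPolynomial.funext fun y => ?_
    have h1 := hP (∑ i, y i • u i)
    have h2 : ∀ j, (inner ℝ (u j) (∑ i, y i • u i) : ℝ) = y j := fun j => hu.inner_right_fintype y j
    simp only [h2] at h1
    rw [← h1, MvPolynomial.aeval_def, MvPolynomial.hom_eval₂, MvPolynomial.eval_eq',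
      MvPolynomial.eval₂_eq']
    refine Finset.sum_congr rfl fun m _ => ?_
    simp [mul_comm]
  rw [heq]
  refine totalDegree_aeval_le (fun k => MvPolynomial.totalDegree_finsetSum_le fun i _ => ?_) P
  refine (MvPolynomial.totalDegree_mul _ _).trans ?_
  simp

theorem IsHiddenSubspacePoly.exists_isNormalizedLink (hP : IsHiddenSubspacePoly r d α U P) :
    ∃ (u : Fin r → EuclideanSpace ℝ (Fin n)) (h : MvPolynomial (Fin r) ℝ),
      Orthonormal ℝ u ∧ Submodule.span ℝ (Set.range u) = U ∧
      (∀ x : EuclideanSpace ℝ (Fin n),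
        MvPolynomial.eval (fun k => x k) P = MvPolynomial.eval (fun i => inner ℝ (u i) x) h) ∧
      h.totalDegree ≤ d ∧ IsNormalizedLink d α h := by
  obtain ⟨u, h, hu, hspan, heval, hnd, hle⟩ := hP.exists_link
  have hm : AEMeasurable (fun x : EuclideanSpace ℝ (Fin n) =>
      (WithLp.toLp 2 fun i => (inner ℝ (u i) x : ℝ) : EuclideanSpace ℝ (Fin r)))
      (stdGaussian (EuclideanSpace ℝ (Fin n))) := by fun_prop
  have hlaw : ∀ p : MvPolynomial (Fin r) ℝ, gaussMean r p =
      ∫ x : EuclideanSpace ℝ (Fin n), MvPolynomial.eval (fun i => (inner ℝ (u i) x : ℝ)) p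
        ∂(stdGaussian (EuclideanSpace ℝ (Fin n))) := by
    intro p
    change ∫ y : EuclideanSpace ℝ (Fin r), _ ∂_ = _
    rw [← stdGaussian_map_orthonormal hu, integral_map hm
      (continuous_eval_euclidean p).aestronglyMeasurable]
  have hmean : gaussMean r h = 0 := by
    rw [hlaw, ← hP.mean_eq_zero]
    exact integral_congr_ae (Filter.Eventually.of_forall fun x => (heval x).symm)
  refine ⟨u, h, hu, hspan, heval, (totalDegree_link_le hu heval).trans hP.degree_le,
    hmean, hnd, hle, ?_⟩
  have hvar := hP.le_variance
  rw [variance_of_integral_eq_zero (continuous_eval_euclidean P).aemeasurable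
    hP.mean_eq_zero] at hvar
  rw [hlaw]
  simpa [heval] using hvar

theorem eval_add_smul_of_mem_orthogonal {u : Fin r → EuclideanSpace ℝ (Fin n)}
    (hspan : Submodule.span ℝ (Set.range u) = U) {h : MvPolynomial (Fin r) ℝ}
    (hP : ∀ x : EuclideanSpace ℝ (Fin n),
      MvPolynomial.eval (fun k => x k) P = MvPolynomial.eval (fun i => inner ℝ (u i) x) h)
    {b : EuclideanSpace ℝ (Fin n)} (hb : b ∈ Uᗮ) (x : EuclideanSpace ℝ (Fin n)) (t : ℝ) :
    MvPolynomial.eval (fun k => (x + t • b) k) P = MvPolynomial.eval (fun k => x k) P := by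
  have hub : ∀ i, (inner ℝ (u i) b : ℝ) = 0 := fun i =>
    (Submodule.mem_orthogonal _ _).1 hb _ (hspan ▸ Submodule.subset_span ⟨i, rfl⟩)
  rw [hP, hP]
  simp [inner_add_right, real_inner_smul_right, hub]

variable {ℓ : ℕ} {v : Fin ℓ → EuclideanSpace ℝ (Fin n)} {ρ : ℝ}

theorem norm_sub_starProjection_le (hv : Orthonormal ℝ v) (hρ : ρ ≤ 1)
    (hvU : ∀ i, 1 - ρ ≤ ‖U.starProjection (v i)‖) (i : Fin ℓ) :
    ‖v i - U.starProjection (v i)‖ ^ 2 ≤ 2 * ρ := by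
  rw [norm_sub_starProjection_sq, hv.1 i]
  nlinarith [hvU i, sq_nonneg ρ]

/-- `b` only sees the part of `v i` off `U`, of squared norm at most `1 - (1 - ρ)² ≤ 2ρ`. This is
the source of `√ρ`. -/
theorem abs_inner_le_of_mem_orthogonal (hv : Orthonormal ℝ v) (hρ : ρ ≤ 1)
    (hvU : ∀ i, 1 - ρ ≤ ‖U.starProjection (v i)‖) {b : EuclideanSpace ℝ (Fin n)}
    (hb : b ∈ Uᗮ) (i : Fin ℓ) : |(inner ℝ (v i) b : ℝ)| ≤ √(2 * ρ) * ‖b‖ := by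
  rw [inner_orthogonal_eq hb]
  refine (abs_real_inner_le_norm _ _).trans ?_
  gcongr
  exact Real.le_sqrt_of_sq_le (norm_sub_starProjection_le hv hρ hvU i)

/-- The trimmed matrix nearly annihilates the orthogonal complement of the hidden subspace. -/
theorem abs_inner_trimmedMatrix_le
    (hinv : ∀ b ∈ Uᗮ, ∀ (x : EuclideanSpace ℝ (Fin n)) (t : ℝ),
      MvPolynomial.eval (fun k => (x + t • b) k) P = MvPolynomial.eval (fun k => x k) P)
    (τ : ℝ) (hv : Orthonormal ℝ v) (hρ : ρ ≤ 1 / 8)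
    (hvU : ∀ i, 1 - ρ ≤ ‖U.starProjection (v i)‖) {b : EuclideanSpace ℝ (Fin n)} (hb : b ∈ Uᗮ)
    (w : EuclideanSpace ℝ (Fin n)) :
    |(inner ℝ b (Matrix.toEuclideanCLM (n := Fin n) (𝕜 := ℝ) (trimmedMatrix P τ v) w) : ℝ)| ≤
      (slabConst + 2) * (ℓ * (√(2 * ρ) * ‖b‖)) * ‖w‖ := by
  set V := Submodule.span ℝ (Set.range v)
  set q := Vᗮ.starProjection w
  have hq : ‖q‖ ≤ ‖w‖ := Vᗮ.norm_starProjection_apply_le w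
  have hvb := abs_inner_le_of_mem_orthogonal hv (by linarith) hvU hb
  have hsqrt : √(2 * ρ) ≤ 1 / 2 := by
    rw [Real.sqrt_le_left (by norm_num)]; linarith
  have hsum : ∑ i, |(inner ℝ (v i) b : ℝ)| ≤ ℓ * (√(2 * ρ) * ‖b‖) := by
    refine (Finset.sum_le_sum fun i _ => hvb i).trans ?_
    simp
  have hVb : ‖V.starProjection b‖ ≤ ℓ * (√(2 * ρ) * ‖b‖) := by
    rw [starProjection_span_range_eq_sum hv]
    refine (norm_sum_le _ _).trans (le_trans (le_of_eq ?_) hsum)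
    refine Finset.sum_congr rfl fun i _ => ?_
    rw [norm_smul, hv.1 i, mul_one, Real.norm_eq_abs]
  have h1 := abs_inner_trimmedMoment_le_of_invariant P τ v (hinv b hb) hv.1 (fun i =>
    (hvb i).trans (by nlinarith [norm_nonneg b])) q
  have h2 := abs_inner_trimmedMoment_le P τ v (V.starProjection b) q
  -- The projection of `b` to `Vᗮ` may leave `Uᗮ`: invariance handles `b`, and the crude bound
  -- handles the small remainder `Π_V b`.
  have hQb : Vᗮ.starProjection b = b - V.starProjection b := by
    rw [V.starProjection_orthogonal']; simp
  rw [inner_trimmedMatrix, hQb, inner_sub_left]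
  refine (abs_sub _ _).trans ((add_le_add h1 h2).trans ?_)
  have hK := slabConst_pos
  calc slabConst * (∑ i, |(inner ℝ (v i) b : ℝ)|) * ‖q‖ + 2 * ‖V.starProjection b‖ * ‖q‖
      ≤ slabConst * (ℓ * (√(2 * ρ) * ‖b‖)) * ‖w‖ + 2 * (ℓ * (√(2 * ρ) * ‖b‖)) * ‖w‖ := by gcongr
    _ = _ := by ring

theorem finrank_sup_span_le {u : Fin r → EuclideanSpace ℝ (Fin n)}
    (hspan : Submodule.span ℝ (Set.range u) = U) :
    Module.finrank ℝ ↥(U ⊔ Submodule.span ℝ (Set.range v)) ≤ r + ℓ := by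
  refine (Submodule.finrank_add_le_finrank_add_finrank _ _).trans (add_le_add ?_ ?_)
  · rw [← hspan]
    simpa [Set.finrank] using finrank_range_le_card (R := ℝ) u
  · simpa [Set.finrank] using finrank_range_le_card (R := ℝ) v

/-- Along a direction orthogonal to both `U` and `V` the event is exactly invariant, so the range of
the symmetric form lies in `U ⊔ V`. This makes the spectral gap independent of `n`. -/
theorem rank_trimmedMatrix_le
    (hinv : ∀ b ∈ Uᗮ, ∀ (x : EuclideanSpace ℝ (Fin n)) (t : ℝ),
      MvPolynomial.eval (fun k => (x + t • b) k) P = MvPolynomial.eval (fun k => x k) P)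
    (τ : ℝ) (hv : Orthonormal ℝ v) :
    (trimmedMatrix P τ v).rank ≤
      Module.finrank ℝ ↥(U ⊔ Submodule.span ℝ (Set.range v)) := by
  set V := Submodule.span ℝ (Set.range v)
  set A := trimmedMatrix P τ v
  have hrange : ∀ w, Matrix.toEuclideanCLM (n := Fin n) (𝕜 := ℝ) A w ∈ U ⊔ V := by
    intro w
    rw [← (U ⊔ V).orthogonal_orthogonal, Submodule.mem_orthogonal]
    intro z hz
    have hzU : z ∈ Uᗮ := Submodule.orthogonal_le le_sup_left hz
    have hzV : z ∈ Vᗮ := Submodule.orthogonal_le le_sup_right hz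
    have hvz : ∀ i, (inner ℝ (v i) z : ℝ) = 0 := fun i =>
      (Submodule.mem_orthogonal _ _).1 hzV _ (Submodule.subset_span ⟨i, rfl⟩)
    rw [inner_trimmedMatrix, Submodule.starProjection_eq_self_iff.2 hzV, ← abs_nonpos_iff]
    refine (abs_inner_trimmedMoment_le_of_invariant P τ v (hinv z hzU) hv.1 (fun i => ?_) _).trans
      (by simp [hvz])
    rw [hvz, abs_zero]
    positivity
  have hle : (LinearMap.range A.mulVecLin).map
      (WithLp.linearEquiv 2 ℝ (Fin n → ℝ)).symm.toLinearMap ≤ U ⊔ V := by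
    rintro _ ⟨_, ⟨y, rfl⟩, rfl⟩
    exact hrange (WithLp.toLp 2 y)
  have := Submodule.finrank_mono hle
  rwa [LinearEquiv.finrank_map_eq] at this

/-- The trimming event has probability bounded below. -/
theorem measureReal_trimEvent_ge {u : Fin r → EuclideanSpace ℝ (Fin n)} (hu : Orthonormal ℝ u)
    (hspan : Submodule.span ℝ (Set.range u) = U) {h : MvPolynomial (Fin r) ℝ}
    (hP : ∀ x : EuclideanSpace ℝ (Fin n),
      MvPolynomial.eval (fun k => x k) P = MvPolynomial.eval (fun i => inner ℝ (u i) x) h)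
    {τ c₀ : ℝ} (hc₀ : ∀ v : Fin ℓ → EuclideanSpace ℝ (Fin r), (∀ i, ‖v i‖ ≤ 1) →
        c₀ ≤ (stdGaussian (EuclideanSpace ℝ (Fin r))).real
          {y | τ < |MvPolynomial.eval (fun i => y i) h| ∧
            ∀ i, |(inner ℝ (v i) y : ℝ)| < 1 / 2})
    (hv : Orthonormal ℝ v) (hρ : ρ ≤ 1) (hvU : ∀ i, 1 - ρ ≤ ‖U.starProjection (v i)‖) :
    c₀ - ℓ * (8 * ρ) ≤
      (stdGaussian (EuclideanSpace ℝ (Fin n))).real (trimEvent P τ v) := by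
  set γ := stdGaussian (EuclideanSpace ℝ (Fin n))
  set Y : EuclideanSpace ℝ (Fin n) → EuclideanSpace ℝ (Fin r) := fun x =>
    WithLp.toLp 2 fun i => (inner ℝ (u i) x : ℝ) with hY
  have hYm : Measurable Y := by fun_prop
  have hYinner : ∀ a x, (inner ℝ (Y a) (Y x) : ℝ) = inner ℝ (U.starProjection a) x := by
    intro a x
    rw [← hspan, starProjection_span_range_eq_sum hu, sum_inner]
    rw [PiLp.inner_apply]
    refine Finset.sum_congr rfl fun i _ => ?_
    simp only [Y, real_inner_smul_left, RCLike.inner_apply, conj_trivial]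
    ring
  have hYnorm : ∀ i, ‖Y (v i)‖ ≤ 1 := by
    intro i
    have h1 : ‖Y (v i)‖ ^ 2 = ‖U.starProjection (v i)‖ ^ 2 := by
      rw [← hspan, norm_sq_starProjection_span_range hu, EuclideanSpace.real_norm_sq_eq]
    rw [(sq_eq_sq₀ (norm_nonneg _) (norm_nonneg _)).1 h1]
    exact (U.norm_starProjection_apply_le _).trans (hv.1 i).le
  set O := {y : EuclideanSpace ℝ (Fin r) | τ < |MvPolynomial.eval (fun i => y i) h| ∧
    ∀ i, |(inner ℝ (Y (v i)) y : ℝ)| < 1 / 2} with hO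
  have hOm : MeasurableSet O := by
    have : MeasurableSet {y : EuclideanSpace ℝ (Fin r) |
        ∀ i, |(inner ℝ (Y (v i)) y : ℝ)| < 1 / 2} := by
      rw [Set.ofPred_forall]
      exact MeasurableSet.iInter fun i => measurableSet_lt (by fun_prop) (by fun_prop)
    exact (measurableSet_setOf_lt_abs_eval h τ).inter this
  have h1 : c₀ ≤ γ.real (Y ⁻¹' O) := by
    have := hc₀ (fun i => Y (v i)) hYnorm
    rwa [← stdGaussian_map_orthonormal hu, map_measureReal_apply hYm hOm] at this
  -- Outside `B i` the off-`U` part of `⟨v i, x⟩` is below `1/2`, so with the slab of half-width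
  -- `1/2` in `U` the total is at most `1`. Markov's inequality gives mass at most `4 · 2ρ`.
  set B : Fin ℓ → Set (EuclideanSpace ℝ (Fin n)) := fun i =>
    {x | (1 / 4 : ℝ) ≤ (inner ℝ (v i - U.starProjection (v i)) x : ℝ) ^ 2} with hB
  have h2 : ∀ i, γ.real (B i) ≤ 8 * ρ := by
    intro i
    have hmk := mul_meas_ge_le_integral_of_nonneg (μ := γ)
      (f := fun x => (inner ℝ (v i - U.starProjection (v i)) x : ℝ) ^ 2)
      (Filter.Eventually.of_forall fun x => sq_nonneg _)
      (memLp_inner_stdGaussian _ 2 (by simp)).integrable_sq (1 / 4)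
    rw [integral_inner_sq_stdGaussian] at hmk
    have := norm_sub_starProjection_le hv hρ hvU i
    change 1 / 4 * γ.real (B i) ≤ _ at hmk
    linarith
  have hsub : Y ⁻¹' O ⊆ trimEvent P τ v ∪ ⋃ i, B i := by
    intro x hx
    by_cases hxB : x ∈ ⋃ i, B i
    · exact Or.inr hxB
    left
    simp only [Set.mem_iUnion, not_exists] at hxB
    obtain ⟨hx1, hx2⟩ := hx
    refine ⟨by rw [hP]; exact hx1, fun i => ?_⟩
    have h3 := hx2 i
    rw [hYinner] at h3
    have h4 : (inner ℝ (v i - U.starProjection (v i)) x : ℝ) ^ 2 < (1 / 2) ^ 2 := by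
      have : ¬(1 / 4 : ℝ) ≤ (inner ℝ (v i - U.starProjection (v i)) x : ℝ) ^ 2 := hxB i
      linarith
    have h5 := abs_lt_of_sq_lt_sq h4 (by norm_num)
    have h6 : (inner ℝ (v i) x : ℝ) = inner ℝ (U.starProjection (v i)) x +
        inner ℝ (v i - U.starProjection (v i)) x := by
      rw [← inner_add_left, add_sub_cancel]
    rw [h6]
    refine (abs_add_le _ _).trans ?_
    linarith
  have h3 : γ.real (Y ⁻¹' O) ≤ γ.real (trimEvent P τ v) + ∑ i, γ.real (B i) :=
    (measureReal_mono hsub).trans ((measureReal_union_le _ _).trans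
      (by gcongr; exact measureReal_iUnion_fintype_le _))
  have h4 : ∑ i, γ.real (B i) ≤ ℓ * (8 * ρ) := by
    refine (Finset.sum_le_sum fun i _ => h2 i).trans ?_
    simp
  linarith

/-- Some unit direction orthogonal to all slab normals has a large trimmed second moment. -/
theorem exists_large_direction {u : Fin r → EuclideanSpace ℝ (Fin n)} (hu : Orthonormal ℝ u)
    (hspan : Submodule.span ℝ (Set.range u) = U) {h : MvPolynomial (Fin r) ℝ}
    (hP : ∀ x : EuclideanSpace ℝ (Fin n),
      MvPolynomial.eval (fun k => x k) P = MvPolynomial.eval (fun i => inner ℝ (u i) x) h)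
    {τ : ℝ} (hτ : ∀ y : EuclideanSpace ℝ (Fin r),
      τ < |MvPolynomial.eval (fun i => y i) h| → √(2 * r + 1) < ‖y‖)
    (hv : Orthonormal ℝ v) (hℓ : ℓ < r) {s : ℝ} (hs : 0 < s)
    (hE : s ≤ (stdGaussian (EuclideanSpace ℝ (Fin n))).real (trimEvent P τ v)) :
    ∃ z : EuclideanSpace ℝ (Fin n), ‖z‖ = 1 ∧
      s / r ≤ inner ℝ z (Matrix.toEuclideanCLM (n := Fin n) (𝕜 := ℝ) (trimmedMatrix P τ v) z) := by
  set γ := stdGaussian (EuclideanSpace ℝ (Fin n))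
  set V := Submodule.span ℝ (Set.range v) with hV
  set Z := Vᗮ ⊓ (U ⊔ V) with hZ
  set k := Module.finrank ℝ Z with hk
  have hkr : k ≤ r := by
    have h1 : Module.finrank ℝ V + k = Module.finrank ℝ ↥(U ⊔ V) :=
      Submodule.finrank_add_inf_finrank_orthogonal le_sup_right
    have h2 : Module.finrank ℝ ↥(U ⊔ V) ≤ r + ℓ := finrank_sup_span_le hspan
    have h3 : Module.finrank ℝ V = ℓ := by
      rw [hV, finrank_span_eq_card hv.linearIndependent, Fintype.card_fin]
    omega
  set e := stdOrthonormalBasis ℝ Z with he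
  set z : Fin k → EuclideanSpace ℝ (Fin n) := fun j => (e j : EuclideanSpace ℝ (Fin n)) with hz
  have hzo : Orthonormal ℝ z := e.orthonormal.comp_linearIsometry Z.subtypeₗᵢ
  have hzspan : Submodule.span ℝ (Set.range z) = Z := by
    have h1 : Set.range z = Z.subtype '' Set.range e := by rw [← Set.range_comp]; rfl
    rw [h1, Submodule.span_image, ← OrthonormalBasis.coe_toBasis, e.toBasis.span_eq,
      Submodule.map_top, Submodule.range_subtype]
  have hzV : ∀ j, Vᗮ.starProjection (z j) = z j := fun j =>
    Submodule.starProjection_eq_self_iff.2 (e j).2.1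
  have hform : ∀ j, (inner ℝ (z j) (Matrix.toEuclideanCLM (n := Fin n) (𝕜 := ℝ)
      (trimmedMatrix P τ v) (z j)) : ℝ) = ∫ x, (trimEvent P τ v).indicator
        (fun x => (inner ℝ (z j) x : ℝ) * inner ℝ (z j) x - inner ℝ (z j) (z j)) x ∂γ := by
    intro j
    rw [inner_trimmedMatrix, ← hV, hzV, inner_trimmedMoment]
  have hEm := measurableSet_trimEvent P τ v
  -- On the event the summed integrand is `‖Π_Z x‖² - k ≥ (2r + 1) - ℓ - k ≥ 1`, so the trace over
  -- `Z` is at least the probability.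
  have hsum : s ≤ ∑ j, (inner ℝ (z j) (Matrix.toEuclideanCLM (n := Fin n) (𝕜 := ℝ)
      (trimmedMatrix P τ v) (z j)) : ℝ) := by
    have hi : ∀ j, Integrable ((trimEvent P τ v).indicator
        (fun x => (inner ℝ (z j) x : ℝ) * inner ℝ (z j) x - inner ℝ (z j) (z j))) γ := fun j =>
      (integrable_inner_mul_inner_sub_stdGaussian (z j) (z j)).indicator hEm
    simp_rw [hform]
    rw [← integral_finsetSum _ fun j _ => hi j]
    refine hE.trans ?_
    rw [← integral_indicator_one hEm]
    refine integral_mono ((integrable_const 1).indicator hEm)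
      (integrable_finsetSum _ fun j _ => hi j) fun x => ?_
    by_cases hx : x ∈ trimEvent P τ v
    · simp only [Set.indicator_of_mem hx, Pi.one_apply, Finset.sum_sub_distrib]
      have h1 : ∑ j, (inner ℝ (z j) x : ℝ) * inner ℝ (z j) x = ‖Z.starProjection x‖ ^ 2 := by
        have h0 := norm_sq_starProjection_span_range hzo x
        simp only [hzspan] at h0
        simp only [h0, sq]
      have h2 : ∑ j, (inner ℝ (z j) (z j) : ℝ) = k := by
        simp [hzo.1]
      have h3 := norm_starProjection_sq_le U V x
      have h4 : ‖V.starProjection x‖ ^ 2 ≤ ℓ := by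
        rw [norm_sq_starProjection_span_range hv]
        have : ∑ i, (inner ℝ (v i) x : ℝ) ^ 2 ≤ ∑ _i : Fin ℓ, (1 : ℝ) :=
          Finset.sum_le_sum fun i _ => (sq_le_one_iff_abs_le_one _).2 (hx.2 i)
        simpa using this
      have h5 : 2 * r + 1 < ‖U.starProjection x‖ ^ 2 := by
        have h6 := hτ (WithLp.toLp 2 fun i => (inner ℝ (u i) x : ℝ)) (by
          have := hx.1
          rwa [hP] at this)
        rw [Real.sqrt_lt' (lt_of_le_of_lt (Real.sqrt_nonneg _) h6),
          EuclideanSpace.real_norm_sq_eq] at h6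
        rwa [← hspan, norm_sq_starProjection_span_range hu]
      have h7 : (ℓ : ℝ) ≤ r := by exact_mod_cast hℓ.le
      have h8 : (k : ℝ) ≤ r := by exact_mod_cast hkr
      rw [h1, h2]
      linarith
    · simp [Set.indicator_of_notMem hx]
  have hr : (0 : ℝ) < r := by exact_mod_cast (Nat.zero_le ℓ).trans_lt hℓ
  by_contra! hcon
  have hlt : ∑ j, (inner ℝ (z j) (Matrix.toEuclideanCLM (n := Fin n) (𝕜 := ℝ)
      (trimmedMatrix P τ v) (z j)) : ℝ) ≤ ∑ _j : Fin k, s / r :=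
    Finset.sum_le_sum fun j _ => (hcon (z j) (hzo.1 j)).le
  rcases Nat.eq_zero_or_pos k with hk0 | hk0
  · have : IsEmpty (Fin k) := by rw [hk0]; infer_instance
    simp at hsum
    linarith
  · have hlt : ∑ j, (inner ℝ (z j) (Matrix.toEuclideanCLM (n := Fin n) (𝕜 := ℝ)
        (trimmedMatrix P τ v) (z j)) : ℝ) < ∑ _j : Fin k, s / r :=
      Finset.sum_lt_sum_of_nonempty ⟨⟨0, hk0⟩, Finset.mem_univ _⟩
        fun j _ => hcon (z j) (hzo.1 j)
    have h8 : (k : ℝ) ≤ r := by exact_mod_cast hkr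
    have h9 : ∑ _j : Fin k, s / r ≤ s := by
      simp only [Finset.sum_const, Finset.card_univ, Fintype.card_fin, nsmul_eq_mul]
      calc (k : ℝ) * (s / r) ≤ r * (s / r) := by gcongr
        _ = s := by field_simp
    linarith

end HiddenSubspace

/-! ### Eigenvector stability and the choice of constants -/

/-- Stability of an eigenvector: if `A` nearly annihilates `Uᗮ`, an eigenvector of a perturbation
`M` of `A` for a large eigenvalue is close to `U`. -/
theorem one_sub_le_norm_starProjection_of_eigenvector {n : ℕ}
    {U : Submodule ℝ (EuclideanSpace ℝ (Fin n))} {A M : Matrix (Fin n) (Fin n) ℝ}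
    {w : EuclideanSpace ℝ (Fin n)} {μ lam ρ K : ℝ} (hK : 0 ≤ K) (hw : ‖w‖ = 1) (hlam : 0 < lam)
    (hμ : lam ≤ μ) (hMw : Matrix.toEuclideanCLM (n := Fin n) (𝕜 := ℝ) M w = μ • w)
    (hρ : ‖M - A‖ ≤ ρ) (hρ1 : ρ ≤ 1)
    (hA : ∀ b ∈ Uᗮ,
      |(inner ℝ b (Matrix.toEuclideanCLM (n := Fin n) (𝕜 := ℝ) A w) : ℝ)| ≤ K * √ρ * ‖b‖) :
    1 - ((1 + K) / lam) ^ 2 * ρ ≤ ‖U.starProjection w‖ := by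
  have hρ0 : 0 ≤ ρ := (norm_nonneg _).trans hρ
  set Φ := Matrix.toEuclideanCLM (n := Fin n) (𝕜 := ℝ) with hΦ
  set b := w - U.starProjection w with hb
  have hbU : b ∈ Uᗮ := U.sub_starProjection_mem_orthogonal w
  have hbw : (inner ℝ b w : ℝ) = ‖b‖ ^ 2 := by
    rw [real_inner_comm, inner_orthogonal_eq hbU, ← hb, real_inner_self_eq_norm_sq]
  have hsplit : μ * ‖b‖ ^ 2 = inner ℝ b (Φ (M - A) w) + inner ℝ b (Φ A w) := by
    rw [map_sub, sub_apply, hMw, inner_sub_right, real_inner_smul_right, hbw]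
    ring
  have h1 : (inner ℝ b (Φ (M - A) w) : ℝ) ≤ ρ * ‖b‖ := by
    refine (real_inner_le_norm _ _).trans ?_
    have : ‖Φ (M - A) w‖ ≤ ρ := by
      refine ((Φ (M - A)).le_opNorm w).trans ?_
      rw [hw, mul_one]
      exact hρ
    rw [mul_comm]
    gcongr
  have h2 := (le_abs_self _).trans (hA b hbU)
  have hsq : √ρ * √ρ = ρ := Real.mul_self_sqrt hρ0
  have hρsqrt : ρ ≤ √ρ := Real.le_sqrt_of_sq_le (by nlinarith)
  have h3 : lam * ‖b‖ ^ 2 ≤ (1 + K) * √ρ * ‖b‖ := by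
    have := mul_le_mul_of_nonneg_right hμ (sq_nonneg ‖b‖)
    have := mul_le_mul_of_nonneg_right hρsqrt (norm_nonneg b)
    linarith
  have h4 : ‖b‖ ≤ (1 + K) / lam * √ρ := by
    rcases (norm_nonneg b).eq_or_lt with h0 | h0
    · rw [← h0]; positivity
    · rw [div_mul_eq_mul_div, le_div_iff₀ hlam]
      refine le_of_mul_le_mul_right ?_ h0
      linarith
  have h5 : ‖b‖ ^ 2 ≤ ((1 + K) / lam) ^ 2 * ρ := by
    calc ‖b‖ ^ 2 ≤ ((1 + K) / lam * √ρ) ^ 2 := by gcongr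
      _ = _ := by rw [mul_pow, Real.sq_sqrt hρ0]
  have h6 := norm_sub_starProjection_sq U w
  have h7 := U.norm_starProjection_apply_le w
  rw [hw] at h6 h7
  nlinarith [norm_nonneg (U.starProjection w)]

theorem mainTheorem8 (r d : ℕ) (α : ℝ) (hα : 0 < α) :
    ∃ τ C : ℝ, 0 < τ ∧ 0 < C ∧
      ∀ (n : ℕ) (U : Submodule ℝ (EuclideanSpace ℝ (Fin n))) (P : MvPolynomial (Fin n) ℝ),
        IsHiddenSubspacePoly r d α U P →
        ∀ (ℓ : ℕ), ℓ < r →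
        ∀ (v : Fin ℓ → EuclideanSpace ℝ (Fin n)) (ρ : ℝ), Orthonormal ℝ v →
          (∀ i, 1 - ρ ≤ ‖U.starProjection (v i)‖) →
          ∀ M : Matrix (Fin n) (Fin n) ℝ, ‖M - trimmedMatrix P τ v‖ ≤ ρ →
          ∀ w : EuclideanSpace ℝ (Fin n), IsTopEigenvector M w →
            1 - C * (max 1 (ℓ : ℝ)) ^ 2 * ρ ≤ ‖U.starProjection w‖ := by
  obtain ⟨τ, c₀, hτ, hc₀, hunif⟩ := exists_uniform_threshold_and_tail r d hα (√(2 * r + 1))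
  -- `r + 1` in place of `r` keeps the constant positive when `r = 0`.
  set lam : ℝ := c₀ / 2 / (r + 1) with hlam
  have hlampos : 0 < lam := by positivity
  -- The three bounds ensure, in order, `√(2ρ) ≤ 1/2`, a probability loss `8ℓρ ≤ c₀/2`, and `ρ`
  -- below the gap `lam / (4 (2r + 1))` for rank `2r`.
  set ρ₀ : ℝ := min (1 / 8) (min (c₀ / (16 * (r + 1))) (lam / (8 * (2 * r + 1)))) with hρ₀
  have hρ₀pos : 0 < ρ₀ := by positivity
  set K : ℝ := (slabConst + 2) * (r * √2) with hK
  have hK0 : 0 ≤ K := by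
    have := slabConst_pos
    positivity
  -- The term `1 / ρ₀` makes the claim trivial for `ρ > ρ₀`. Since `K` already replaces `ℓ` by `r`,
  -- the factor `max(1, ℓ)²` is used only through being at least `1`.
  refine ⟨τ, 1 / ρ₀ + ((1 + K) / (lam / 2)) ^ 2, hτ, by positivity, ?_⟩
  intro n U P hP ℓ hℓ v ρ hv hvU M hM w hw
  have hρ0 : 0 ≤ ρ := (norm_nonneg _).trans hM
  have hL : (1 : ℝ) ≤ (max 1 (ℓ : ℝ)) ^ 2 := one_le_pow₀ (le_max_left _ _)
  have hCρ : (1 / ρ₀ + ((1 + K) / (lam / 2)) ^ 2) * ρ ≤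
      (1 / ρ₀ + ((1 + K) / (lam / 2)) ^ 2) * (max 1 (ℓ : ℝ)) ^ 2 * ρ := by
    gcongr
    exact le_mul_of_one_le_right (by positivity) hL
  rw [add_mul] at hCρ
  rcases lt_or_ge ρ₀ ρ with hlarge | hsmall
  · have h1 : 1 ≤ 1 / ρ₀ * ρ := by
      rw [div_mul_eq_mul_div, one_mul, le_div_iff₀ hρ₀pos]; linarith
    have h2 : 0 ≤ ((1 + K) / (lam / 2)) ^ 2 * ρ := by positivity
    linarith [norm_nonneg (U.starProjection w)]
  have hρ8 : ρ ≤ 1 / 8 := hsmall.trans (min_le_left _ _)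
  have hρc : ρ ≤ c₀ / (16 * (r + 1)) :=
    hsmall.trans ((min_le_right _ _).trans (min_le_left _ _))
  have hρlam : ρ ≤ lam / (8 * (2 * r + 1)) :=
    hsmall.trans ((min_le_right _ _).trans (min_le_right _ _))
  obtain ⟨u, h, hu, hspan, heval, hdeg, hlink⟩ := hP.exists_isNormalizedLink
  obtain ⟨hthr, htail⟩ := hunif h hdeg hlink
  obtain ⟨hw1, μ, hMw, hspec⟩ := hw
  have hℓr : (ℓ : ℝ) ≤ r := by exact_mod_cast hℓ.le
  have hinv := fun b (hb : b ∈ Uᗮ) => eval_add_smul_of_mem_orthogonal hspan heval hb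
  have hE : c₀ / 2 ≤ (stdGaussian (EuclideanSpace ℝ (Fin n))).real (trimEvent P τ v) := by
    refine le_trans ?_ (measureReal_trimEvent_ge hu hspan heval (htail ℓ hℓ) hv (by linarith) hvU)
    rw [le_div_iff₀ (by positivity)] at hρc
    have : (ℓ : ℝ) * ρ ≤ (r + 1) * ρ := by gcongr; linarith
    linarith
  obtain ⟨z, hz, hzA⟩ := exists_large_direction hu hspan heval hthr hv hℓ (by positivity) hE
  have hr : (0 : ℝ) < r := by exact_mod_cast (Nat.zero_le ℓ).trans_lt hℓ
  have hlamle : lam ≤ c₀ / 2 / r := by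
    rw [hlam]; gcongr; linarith
  have hrank : (trimmedMatrix P τ v).rank ≤ 2 * r :=
    (rank_trimmedMatrix_le hinv τ hv).trans ((finrank_sup_span_le hspan).trans (by omega))
  have hμ : lam / 2 ≤ μ := by
    refine half_le_of_spectrum_re_le (trimmedMatrix_isHermitian P τ v) hrank hlampos hM ?_ hz
      (hlamle.trans hzA) hspec
    refine hρlam.trans_lt ?_
    push_cast
    gcongr
    norm_num
  have hmain := one_sub_le_norm_starProjection_of_eigenvector hK0 hw1 (half_pos hlampos) hμ hMw hM
    (by linarith) (fun b hb => by
      refine (abs_inner_trimmedMatrix_le hinv τ hv hρ8 hvU hb w).trans ?_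
      rw [hw1, mul_one, hK, Real.sqrt_mul zero_le_two]
      have := slabConst_pos
      calc (slabConst + 2) * (ℓ * (√2 * √ρ * ‖b‖)) ≤ (slabConst + 2) * (r * (√2 * √ρ * ‖b‖)) := by
            gcongr
        _ = _ := by ring)
  have h2 : 0 ≤ 1 / ρ₀ * ρ := by positivity
  linarith
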